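/- Let $\alpha>0$, $M>0$, $M_0>1$ and $0<\rho<M_0$. For $p\ge 1$ let $\mathcal F_\alpha(M_0,M)$ be the set of real symmetric $p\times p$ matrices $\Omega=(\omega_{ij})$ all of whose eigenvalues lie in $[M_0^{-1},M_0]$ and which satisfy $$\max_j\sum_{i:\,|i-j|\ge k}|\omega_{ij}|\le M k^{-\alpha}\qquad\text{for all integers }k\ge 1 .$$ Let $\mathcal P_\alpha=\mathcal P_\alpha(M_0,M,\rho)$ be the set of probability laws $P$ on $\mathbb R^p$ with finite second moments and invertible covariance matrix $\Sigma(P)$ whose precision matrix $\Omega(P)=\Sigma(P)^{-1}$ lies in $\mathcal F_\alpha(M_0,M)$ and which satisfy, for $\mathbf x\sim P$, $$\mathbb P\{|v^{\top}(\mathbf x-\mathbb E\mathbf x)|>t\}\le e^{-t^2\rho/2}\qquad\text{for all }t>0\text{ and all }v\in\mathbb R^p\text{ with }\|v\|_2=1 .$$ For every $K>0$ there is a constant $c>0$, depending only on $\alpha,M,M_0,\rho,K$, such that for all integers $n\ge 1$ and $p$ with $p>n^{1/(2\alpha+1)}$ and $\log p\le Kn$, $$\inf_{\hat\Omega}\ \sup_{P\in\mathcal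 P_\alpha}\ \mathbb E_P\big\|\hat\Omega(\mathbf x_1,\dots,\mathbf x_n)-\Omega(P)\big\|^2\ \ge\ c\,n^{-\frac{2\alpha}{2\alpha+1}}+c\,\frac{\log p}{n},$$ where $\mathbf x_1,\dots,\mathbf x_n$ are i.i.d. with law $P$, the infimum is over all measurable functions $\hat\Omega:(\mathbb R^p)^n\to\mathbb R^{p\times p}$, and $\|\cdot\|$ is the operator (spectral) norm. The same bound holds when the supremum is taken only over the laws $P\in\mathcal P_\alpha$ with mean zero. -/

import Mathlib

open MeasureTheory ProbabilityTheory
open scoped ENNReal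

noncomputable section

/-- The parameter space `F_α(M₀, M)`: real symmetric `p × p` matrices whose off-diagonal mass in
every column decays like `M k^(-α)` (for every integer `k ≥ 1`), and all of whose eigenvalues lie
in `[M₀⁻¹, M₀]`. -/
def bandableMatrices (p : ℕ) (α M₀ M : ℝ) : Set (Matrix (Fin p) (Fin p) ℝ) :=
  {Ω | Ω.IsSymm ∧
    (∀ k : ℕ, 1 ≤ k → ∀ j : Fin p,
      ∑ i ∈ Finset.univ.filter (fun i : Fin p => (k : ℤ) ≤ |((i : ℕ) : ℤ) - ((j : ℕ) : ℤ)|),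
        |Ω i j| ≤ M * (k : ℝ) ^ (-α)) ∧
    ∀ l : ℝ, Module.End.HasEigenvalue (Matrix.toLin' Ω) l → l ∈ Set.Icc M₀⁻¹ M₀}

/-- The covariance matrix of a law on `ℝ^p`. -/
def covarianceMatrix {p : ℕ} (P : Measure (EuclideanSpace ℝ (Fin p))) :
    Matrix (Fin p) (Fin p) ℝ :=
  Matrix.of fun i j => cov[fun x => x i, fun x => x j; P]

/-- The precision matrix `Ω(P) = Σ(P)⁻¹` of a law on `ℝ^p`. -/
def precisionMatrix {p : ℕ} (P : Measure (EuclideanSpace ℝ (Fin p))) :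
    Matrix (Fin p) (Fin p) ℝ :=
  (covarianceMatrix P)⁻¹

/-- Subgaussian tails with parameter `ρ`, uniformly over all directions:
`P(|⟨v, x - E x⟩| > t) ≤ exp(-t² ρ / 2)` for all `t > 0` and all unit vectors `v`. -/
def HasSubgaussianTails {p : ℕ} (ρ : ℝ) (P : Measure (EuclideanSpace ℝ (Fin p))) : Prop :=
  ∀ v : EuclideanSpace ℝ (Fin p), ‖v‖ = 1 → ∀ t : ℝ, 0 < t →
    P.real {x | t < |inner ℝ v (x - ∫ y, y ∂P)|} ≤ Real.exp (-(t ^ 2 * ρ / 2))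

/-- The class `P_α(M₀, M, ρ)` of laws on `ℝ^p` with finite second moments, subgaussian tails with
parameter `ρ`, and an invertible covariance matrix whose inverse lies in `F_α(M₀, M)`. -/
def bandablePrecisionLaws (p : ℕ) (α M₀ M ρ : ℝ) :
    Set (Measure (EuclideanSpace ℝ (Fin p))) :=
  {P | IsProbabilityMeasure P ∧ MemLp (fun x => x) 2 P ∧ HasSubgaussianTails ρ P ∧
    IsUnit (covarianceMatrix P) ∧ precisionMatrix P ∈ bandableMatrices p α M₀ M}

/-- The spectral norm of a matrix: its operator norm on Euclidean space. -/
def matrixSpectralNorm {p : ℕ} (A : Matrix (Fin p) (Fin p) ℝ) : ℝ :=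
  ‖Matrix.toEuclideanCLM (n := Fin p) (𝕜 := ℝ) A‖

/-- An estimator from `n` observations in `ℝ^p`: a measurable matrix-valued function of the sample
(measurability is stated entrywise). -/
def IsEstimator {n p : ℕ}
    (est : (Fin n → EuclideanSpace ℝ (Fin p)) → Matrix (Fin p) (Fin p) ℝ) : Prop :=
  ∀ i j, Measurable fun x => est x i j

/-- The risk `E ‖Ω̂(x₁, …, x_n) - Ω(P)‖²` for `x₁, …, x_n` i.i.d. with law `P`, as an element of
`[0, ∞]`. -/
def operatorNormRisk {n p : ℕ}
    (est : (Fin n → EuclideanSpace ℝ (Fin p)) → Matrix (Fin p) (Fin p) ℝ)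
    (P : Measure (EuclideanSpace ℝ (Fin p))) : ℝ≥0∞ :=
  ∫⁻ x, ENNReal.ofReal (matrixSpectralNorm (est x - precisionMatrix P) ^ 2)
    ∂(Measure.pi fun _ : Fin n => P)

/-- The minimax risk, from `n` i.i.d. observations, for estimating the precision matrix over a
class of laws: the infimum over all estimators of the supremum of the risk over the class. -/
def operatorNormMinimaxRisk (n : ℕ) {p : ℕ} (C : Set (Measure (EuclideanSpace ℝ (Fin p)))) : ℝ≥0∞ :=
  ⨅ (est : (Fin n → EuclideanSpace ℝ (Fin p)) → Matrix (Fin p) (Fin p) ℝ) (_ : IsEstimator est),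
    ⨆ P ∈ C, operatorNormRisk est P

end

/-!
Only centred Gaussian laws are used: `gaussianLaw A` is the law of `A g` for a standard Gaussian
vector `g`, and for `A * B = 1` its precision matrix is `Bᵀ * B`. Such a law satisfies the
subgaussian tail bound (which has no leading constant, like the two-sided Gaussian tail
`P(|Z| > t) ≤ exp (-t² / 2)`) and the eigenvalue bounds as soon as `‖B x‖² / ‖x‖²` stays in
`[max ρ M₀⁻¹, M₀]` (`gaussianLaw_mem`). As `ρ < M₀` and `M₀ > 1`, this window has nonempty interior:
all the matrices `Bᵀ * B` below are small perturbations of `a • 1` with `a` in its interior. Since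
these laws have mean zero, it suffices to bound the smaller of the two minimax risks.

Indistinguishability is measured by second moments of likelihood ratios: a test of `μ` against
`μ.withDensity L` has total error at least `1 / 2` if `∫ L² ∂μ ≤ 2` (`half_le_testing_error`), and
for `n`-fold products and mixtures that second moment is computed from one observation
(`half_le_testing_error_pi`). All perturbations act on a single coordinate of `g`, by a map that may
depend on the other coordinates, so that the density is one-dimensional by Tonelli
(`map_update_pi`).

The term `log p / n` comes from raising one of the `p` diagonal entries of `a • 1` by a multiple of
`√(log p / n)` (`le_minimaxRisk_of_spikes`). The likelihood ratios for two different positions are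
uncorrelated, so mixing over the position makes the change undetectable.

The term `n ^ (-2α / (2α + 1))` comes from `B = √a (1 + e u_θ wᵀ)`, where `w` is the indicator of the
block `[k, 2k)` and `u_θ` a vector of arbitrary signs on `[0, k)`, with `k ≍ n ^ (1 / (2α + 1))` and
`e ≍ k ^ (-α - 1)`. Flipping one sign is a shear of `g`, undetectable because `n e² k` is bounded
(`half_le_flip_testing_error`). Applied to `w / √k`, the error of an estimator has `i`-th coordinate
at least `a e √k` whenever the `i`-th sign is guessed wrong, so the losses add up over the `k`
positions, which gives `k (a e √k)² = a² e² k² ≍ k ^ (-2α)` (`le_minimaxRisk_of_shears`).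
-/

/-! ### Product measures -/

lemma lintegral_pi_prod {ι : Type*} [Fintype ι] {X : ι → Type*} [∀ i, MeasurableSpace (X i)]
    (μ : ∀ i, Measure (X i)) [∀ i, IsProbabilityMeasure (μ i)] {f : ∀ i, X i → ℝ≥0∞}
    (hf : ∀ i, Measurable (f i)) :
    ∫⁻ x, ∏ i, f i (x i) ∂(Measure.pi μ) = ∏ i, ∫⁻ y, f i y ∂(μ i) := by
  have hind : iIndepFun (fun i (x : ∀ i, X i) => f i (x i)) (Measure.pi μ) :=
    iIndepFun_pi fun i => (hf i).aemeasurable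
  have h := lintegral_prod_eq_prod_lintegral_of_indepFun Finset.univ _ hind
    (fun i => (hf i).comp (measurable_pi_apply i))
  rw [h]
  refine Finset.prod_congr rfl fun i _ => ?_
  exact (measurePreserving_eval μ i).lintegral_comp (hf i)

lemma pi_withDensity {ι : Type*} [Fintype ι] {X : ι → Type*} [∀ i, MeasurableSpace (X i)]
    (μ : ∀ i, Measure (X i)) [∀ i, IsProbabilityMeasure (μ i)] {f : ∀ i, X i → ℝ≥0∞}
    (hf : ∀ i, Measurable (f i)) [∀ i, IsProbabilityMeasure ((μ i).withDensity (f i))] :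
    Measure.pi (fun i => (μ i).withDensity (f i))
      = (Measure.pi μ).withDensity fun x => ∏ i, f i (x i) := by
  symm
  refine Measure.pi_eq (μ := fun i => (μ i).withDensity (f i)) |> fun h => (h ?_).symm
  intro s hs
  rw [withDensity_apply _ (MeasurableSet.univ_pi hs),
    ← lintegral_indicator (MeasurableSet.univ_pi hs)]
  have : ∀ x : ∀ i, X i, (Set.univ.pi s).indicator (fun x => ∏ i, f i (x i)) x
      = ∏ i, (s i).indicator (f i) (x i) := by
    intro x
    by_cases hx : x ∈ Set.univ.pi s
    · rw [Set.indicator_of_mem hx]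
      exact Finset.prod_congr rfl fun i _ => (Set.indicator_of_mem (hx i trivial) _).symm
    · rw [Set.indicator_of_notMem hx]
      simp only [Set.mem_pi, not_forall] at hx
      obtain ⟨i, _, hi⟩ := hx
      exact (Finset.prod_eq_zero (Finset.mem_univ i) (Set.indicator_of_notMem hi _)).symm
  simp_rw [this]
  rw [lintegral_pi_prod μ fun i => (hf i).indicator (hs i)]
  refine Finset.prod_congr rfl fun i _ => ?_
  rw [lintegral_indicator (hs i), withDensity_apply _ (hs i)]

/-- Tonelli's theorem in the form "resample one coordinate". -/
lemma lintegral_pi_update {ι : Type*} [Fintype ι] [DecidableEq ι] {X : Type*} [MeasurableSpace X]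
    (ν : Measure X) [IsProbabilityMeasure ν] (i : ι) {f : (ι → X) → ℝ≥0∞} (hf : Measurable f) :
    ∫⁻ x, f x ∂(Measure.pi fun _ => ν)
      = ∫⁻ x, ∫⁻ t, f (Function.update x i t) ∂ν ∂(Measure.pi fun _ => ν) := by
  have key : ∀ x, ∫⁻ t, f (Function.update x i t) ∂ν = (∫⋯∫⁻_{i}, f ∂fun _ => ν) x := by
    intro x; rw [lmarginal_singleton]
  simp_rw [key]
  refine lintegral_eq_of_lmarginal_eq {i} hf (hf.lmarginal _) ?_
  funext x
  rw [lmarginal_singleton (∫⋯∫⁻_{i}, f ∂fun _ => ν) i]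
  have hu : ∀ t, (∫⋯∫⁻_{i}, f ∂fun _ => ν) (Function.update x i t)
      = (∫⋯∫⁻_{i}, f ∂fun _ => ν) x := fun t =>
    lmarginal_update_of_mem (μ := fun _ => ν) (Finset.mem_singleton_self i) f x t
  simp_rw [hu]
  simp

/-- Moving the `i`-th coordinate by a map that depends on the other coordinates changes a product
measure by the fibrewise density. -/
lemma map_update_pi {ι : Type*} [Fintype ι] [DecidableEq ι] {X : Type*} [MeasurableSpace X]
    (ν : Measure X) [IsProbabilityMeasure ν] (i : ι) {h : (ι → X) → X → X}
    {l : (ι → X) → X → ℝ≥0∞} (hh : Measurable (Function.uncurry h))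
    (hl : Measurable (Function.uncurry l))
    (hhi : ∀ x t, h (Function.update x i t) = h x) (hli : ∀ x t, l (Function.update x i t) = l x)
    (hmap : ∀ x, ν.map (h x) = ν.withDensity (l x)) :
    (Measure.pi fun _ : ι => ν).map (fun x => Function.update x i (h x (x i)))
      = (Measure.pi fun _ : ι => ν).withDensity fun x => l x (x i) := by
  have hhx : ∀ x, Measurable (h x) := fun x => hh.comp measurable_prodMk_left
  have hlx : ∀ x, Measurable (l x) := fun x => hl.comp measurable_prodMk_left
  have hS : Measurable fun x : ι → X => Function.update x i (h x (x i)) := by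
    refine measurable_pi_iff.2 fun j => ?_
    by_cases hj : j = i
    · subst hj
      simpa [Function.comp_def] using hh.comp (measurable_id.prodMk (measurable_pi_apply j))
    · simpa [hj] using measurable_pi_apply j
  have hL : Measurable fun x : ι → X => l x (x i) :=
    hl.comp (measurable_id.prodMk (measurable_pi_apply i))
  refine Measure.ext_of_lintegral _ fun f hf => ?_
  rw [lintegral_map hf hS, lintegral_withDensity_eq_lintegral_mul _ hL hf,
    lintegral_pi_update ν i (hL.mul hf)]
  refine (lintegral_pi_update ν i (hf.comp hS)).trans ?_
  refine lintegral_congr fun x => ?_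
  have hu : Measurable fun t => f (Function.update x i t) := hf.comp (measurable_update x)
  have := lintegral_map (μ := ν) hu (hhx x)
  rw [hmap, lintegral_withDensity_eq_lintegral_mul _ (hlx x) hu] at this
  simpa [hhi, hli] using this.symm

/-! ### A testing inequality -/

/-- The two errors of a test of `μ` against `μ.withDensity L` add up to at least `1/2` if
`∫ L² ∂μ ≤ 2`: the sum is at least `∫ min 1 L`, and `min 1 L ≥ L - L² / 4`. -/
lemma half_le_testing_error {X : Type*} [MeasurableSpace X] (μ : Measure X)
    {L : X → ℝ≥0∞} (hL : Measurable L) (h1 : ∫⁻ x, L x ∂μ = 1) (h2 : ∫⁻ x, L x ^ 2 ∂μ ≤ 2)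
    {D : Set X} (hD : MeasurableSet D) :
    1 / 2 ≤ μ D + ∫⁻ x in Dᶜ, L x ∂μ := by
  have hmin : ∫⁻ x, min 1 (L x) ∂μ ≤ μ D + ∫⁻ x in Dᶜ, L x ∂μ := by
    rw [← lintegral_add_compl _ hD]
    gcongr
    · calc ∫⁻ x in D, min 1 (L x) ∂μ ≤ ∫⁻ x in D, 1 ∂μ := by gcongr; exact min_le_left _ _
        _ = μ D := by simp
    · exact min_le_right _ _
  have hpt : ∀ x, L x ≤ min 1 (L x) + 4⁻¹ * L x ^ 2 := by
    intro x
    rcases le_total (L x) 1 with h | h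
    · rw [min_eq_right h]; exact le_self_add
    · rw [min_eq_left h]
      by_cases ht : L x = ∞
      · simp [ht]
      lift L x to NNReal using ht with y
      have h4 : (4 : ℝ≥0∞)⁻¹ = ((4⁻¹ : NNReal) : ℝ≥0∞) := by
        rw [ENNReal.coe_inv (by norm_num)]; norm_num
      rw [h4]
      norm_cast
      rw [← NNReal.coe_le_coe]
      push_cast
      nlinarith [sq_nonneg ((y : ℝ) - 2)]
  have h3 : (1 : ℝ≥0∞) ≤ ∫⁻ x, min 1 (L x) ∂μ + 2⁻¹ := by
    calc (1 : ℝ≥0∞) = ∫⁻ x, L x ∂μ := h1.symm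
      _ ≤ ∫⁻ x, (min 1 (L x) + 4⁻¹ * L x ^ 2) ∂μ := lintegral_mono hpt
      _ = ∫⁻ x, min 1 (L x) ∂μ + 4⁻¹ * ∫⁻ x, L x ^ 2 ∂μ := by
        rw [lintegral_add_right _ (by fun_prop), lintegral_const_mul _ (by fun_prop)]
      _ ≤ ∫⁻ x, min 1 (L x) ∂μ + 4⁻¹ * 2 := by gcongr
      _ = ∫⁻ x, min 1 (L x) ∂μ + 2⁻¹ := by
        congr 1
        rw [show (4 : ℝ≥0∞) = 2 * 2 by norm_num,
          ENNReal.mul_inv (by simp) (by simp), mul_assoc,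
          ENNReal.inv_mul_cancel (by simp) (by simp), mul_one]
  refine le_trans ?_ hmin
  rw [one_div]
  have := tsub_le_iff_right.2 h3
  rwa [ENNReal.one_sub_inv_two] at this

/-- Testing an `n`-fold product of one law against the uniform mixture of the `n`-fold products of
finitely many others, the likelihood ratios being given upstairs, on a space from which all the
laws are images under the same map. -/
lemma half_le_testing_error_pi {Z X ι : Type*} [MeasurableSpace Z] [MeasurableSpace X]
    [Fintype ι] [Nonempty ι] (μ : Measure Z) [IsProbabilityMeasure μ] {T : Z → X}
    (hT : Measurable T) {L : ι → Z → ℝ≥0∞} (hL : ∀ m, Measurable (L m))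
    (h1 : ∀ m, ∫⁻ z, L m z ∂μ = 1) (n : ℕ)
    (h2 : ∑ m, ∑ m', (∫⁻ z, L m z * L m' z ∂μ) ^ n ≤ 2 * (Fintype.card ι : ℝ≥0∞) ^ 2)
    {D : Set (Fin n → X)} (hD : MeasurableSet D) :
    1 / 2 ≤ Measure.pi (fun _ => μ.map T) D
      + (Fintype.card ι : ℝ≥0∞)⁻¹ *
        ∑ m, Measure.pi (fun _ => (μ.withDensity (L m)).map T) Dᶜ := by
  set N : ℝ≥0∞ := (Fintype.card ι : ℝ≥0∞) with hN
  have hN0 : N ≠ 0 := by simp [hN]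
  have hNt : N ≠ ∞ := by simp [hN]
  have hprob : ∀ m, IsProbabilityMeasure (μ.withDensity (L m)) := fun m =>
    ⟨by rw [withDensity_apply _ MeasurableSet.univ, setLIntegral_univ, h1]⟩
  set S : (Fin n → Z) → (Fin n → X) := fun z j => T (z j) with hS
  have hSm : Measurable S := measurable_pi_iff.2 fun j => hT.comp (measurable_pi_apply j)
  have hpush : ∀ κ : Measure Z, IsProbabilityMeasure κ →
      Measure.pi (fun _ : Fin n => κ.map T) = (Measure.pi fun _ : Fin n => κ).map S := by
    intro κ hκ
    have : IsProbabilityMeasure (κ.map T) := Measure.isProbabilityMeasure_map hT.aemeasurable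
    exact (Measure.pi_map_pi (μ := fun _ : Fin n => κ) (f := fun _ => T)
      fun _ => hT.aemeasurable).symm
  have hden : ∀ m, Measure.pi (fun _ : Fin n => μ.withDensity (L m))
      = (Measure.pi fun _ : Fin n => μ).withDensity fun z => ∏ j, L m (z j) := fun m =>
    pi_withDensity (fun _ : Fin n => μ) (f := fun _ => L m) fun _ => hL m
  set L' : (Fin n → Z) → ℝ≥0∞ := fun z => N⁻¹ * ∑ m, ∏ j, L m (z j) with hL'
  have hPm : ∀ m, Measurable fun z : Fin n → Z => ∏ j, L m (z j) := fun m =>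
    Finset.measurable_prod _ fun j _ => (hL m).comp (measurable_pi_apply j)
  have hLm : Measurable L' := (Finset.measurable_sum _ fun m _ => hPm m).const_mul _
  have hD' : MeasurableSet (S ⁻¹' D) := hSm hD
  have key := half_le_testing_error (Measure.pi fun _ : Fin n => μ) hLm ?_ ?_ hD'
  · rw [hpush μ inferInstance, Measure.map_apply hSm hD]
    convert key using 2
    rw [hL', lintegral_const_mul _ (Finset.measurable_sum _ fun m _ => hPm m),
      lintegral_finsetSum _ fun m _ => hPm m]
    congr 1
    refine Finset.sum_congr rfl fun m _ => ?_
    rw [hpush _ (hprob m), Measure.map_apply hSm hD.compl, hden,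
      withDensity_apply _ (hSm hD.compl)]
    rfl
  · rw [hL', lintegral_const_mul _ (Finset.measurable_sum _ fun m _ => hPm m),
      lintegral_finsetSum _ fun m _ => hPm m]
    have : ∀ m, ∫⁻ z, ∏ j, L m (z j) ∂(Measure.pi fun _ : Fin n => μ) = 1 := fun m => by
      rw [lintegral_pi_prod (fun _ : Fin n => μ) fun _ => hL m]; simp [h1]
    simp [this, ← hN, ENNReal.inv_mul_cancel hN0 hNt]
  · have : ∀ z, L' z ^ 2 = (N⁻¹) ^ 2 * ∑ m, ∑ m', ∏ j, (L m (z j) * L m' (z j)) := fun z => by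
      simp_rw [hL', mul_pow, pow_two (∑ m, _), Finset.sum_mul_sum, Finset.prod_mul_distrib]
    simp_rw [this]
    have hm2 : ∀ m m', Measurable fun z : Fin n → Z => ∏ j, (L m (z j) * L m' (z j)) :=
      fun m m' => Finset.measurable_prod _ fun j _ =>
        ((hL m).comp (measurable_pi_apply j)).mul ((hL m').comp (measurable_pi_apply j))
    rw [lintegral_const_mul _ (Finset.measurable_sum _ fun m _ =>
        Finset.measurable_sum _ fun m' _ => hm2 m m'),
      lintegral_finsetSum _ fun m _ => Finset.measurable_sum _ fun m' _ => hm2 m m']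
    simp_rw [lintegral_finsetSum _ fun m' _ => hm2 _ m']
    have h3 : ∀ m m', ∫⁻ z, ∏ j, (L m (z j) * L m' (z j)) ∂(Measure.pi fun _ : Fin n => μ)
        = (∫⁻ z, L m z * L m' z ∂μ) ^ n := fun m m' => by
      refine (lintegral_pi_prod (fun _ : Fin n => μ) fun _ => (hL m).mul (hL m')).trans ?_
      simp
    simp_rw [h3]
    calc (N⁻¹) ^ 2 * _ ≤ (N⁻¹) ^ 2 * (2 * N ^ 2) := by gcongr
      _ = (N⁻¹ * N) ^ 2 * 2 := by ring
      _ = 2 := by rw [ENNReal.inv_mul_cancel hN0 hNt]; simp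

/-! ### One-dimensional Gaussian computations -/

lemma gaussianReal_withDensity_eq {m : ℝ} {v : NNReal} (hv : v ≠ 0) {f : ℝ → ℝ}
    (hf : Measurable f)
    (h : ∀ t, gaussianPDFReal 0 1 t * f t = gaussianPDFReal m v t) :
    gaussianReal m v = (gaussianReal 0 1).withDensity fun t => ENNReal.ofReal (f t) := by
  rw [gaussianReal_of_var_ne_zero _ hv, gaussianReal_of_var_ne_zero _ one_ne_zero,
    ← withDensity_mul _ (measurable_gaussianPDF 0 1) hf.ennreal_ofReal]
  congr 1
  funext t
  simp only [Pi.mul_apply, gaussianPDF]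
  rw [← ENNReal.ofReal_mul (gaussianPDFReal_nonneg 0 1 t), h]

lemma gaussianReal_map_add_eq_withDensity (c : ℝ) :
    (gaussianReal 0 1).map (fun t => t + c)
      = (gaussianReal 0 1).withDensity fun t => ENNReal.ofReal (Real.exp (c * t - c ^ 2 / 2)) := by
  rw [gaussianReal_map_add_const]
  refine gaussianReal_withDensity_eq one_ne_zero (by fun_prop) fun t => ?_
  simp only [gaussianPDFReal, mul_assoc, ← Real.exp_add]
  congr 3
  simp only [NNReal.coe_one]
  ring

lemma gaussianReal_map_div_eq_withDensity {s : ℝ} (hs : 0 < s) :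
    (gaussianReal 0 1).map (fun t => t / s)
      = (gaussianReal 0 1).withDensity fun t =>
        ENNReal.ofReal (s * Real.exp (-((s ^ 2 - 1) / 2) * t ^ 2)) := by
  rw [gaussianReal_map_div_const]
  refine gaussianReal_withDensity_eq ?_ (by fun_prop) fun t => ?_
  · rw [← NNReal.coe_ne_zero]
    simp [hs.ne']
  simp only [gaussianPDFReal]
  have h1 : (√(2 * Real.pi * ((1 / .mk (s ^ 2) (sq_nonneg s) : NNReal) : ℝ)))⁻¹
      = (√(2 * Real.pi * ((1 : NNReal) : ℝ)))⁻¹ * s := by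
    rw [NNReal.coe_div]
    simp only [NNReal.coe_one, NNReal.coe_mk, mul_one]
    rw [mul_one_div, Real.sqrt_div (by positivity), Real.sqrt_sq hs.le, inv_div, div_eq_inv_mul]
  rw [h1]
  rw [mul_mul_mul_comm, ← mul_assoc, mul_assoc _ (Real.exp _), ← Real.exp_add]
  congr 2
  simp
  field_simp
  ring

lemma lintegral_exp_sq_gaussianReal {b : ℝ} (hb : b < 1 / 2) :
    ∫⁻ t, ENNReal.ofReal (Real.exp (b * t ^ 2)) ∂(gaussianReal 0 1)
      = ENNReal.ofReal (√(1 - 2 * b))⁻¹ := by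
  have hb' : 0 < 1 - 2 * b := by linarith
  set s := √(1 - 2 * b) with hs
  have hs0 : 0 < s := Real.sqrt_pos.2 hb'
  have hs2 : s ^ 2 = 1 - 2 * b := Real.sq_sqrt hb'.le
  have h := congrArg (fun κ : Measure ℝ => κ Set.univ) (gaussianReal_map_div_eq_withDensity hs0)
  simp only [withDensity_apply _ MeasurableSet.univ, setLIntegral_univ] at h
  rw [Measure.map_apply (by fun_prop) MeasurableSet.univ, Set.preimage_univ, measure_univ] at h
  simp_rw [ENNReal.ofReal_mul hs0.le] at h
  rw [lintegral_const_mul _ (by fun_prop), hs2] at h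
  rw [ENNReal.ofReal_inv_of_pos hs0]
  refine ENNReal.eq_inv_of_mul_eq_one_left ?_
  rw [mul_comm, h]
  congr 3
  funext t
  congr 3
  ring

lemma lintegral_exp_sq_gaussianReal_le {b : ℝ} (hb0 : 0 ≤ b) (hb : b ≤ 1 / 4) :
    ∫⁻ t, ENNReal.ofReal (Real.exp (b * t ^ 2)) ∂(gaussianReal 0 1)
      ≤ ENNReal.ofReal (Real.exp (2 * b)) := by
  rw [lintegral_exp_sq_gaussianReal (by linarith)]
  refine ENNReal.ofReal_le_ofReal ?_
  have h1 : 1 ≤ (1 - 2 * b) * Real.exp (2 * b) ^ 2 := by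
    rw [← Real.exp_nat_mul]
    have := Real.add_one_le_exp ((2 : ℕ) * (2 * b))
    push_cast at this ⊢
    nlinarith
  have h2 : 0 < √(1 - 2 * b) := Real.sqrt_pos.2 (by linarith)
  rw [inv_le_iff_one_le_mul₀ h2]
  refine le_of_sq_le_sq ?_ (by positivity)
  rw [mul_pow, Real.sq_sqrt (by linarith)]
  linarith

lemma lintegral_exp_mul_gaussianReal (c : ℝ) :
    ∫⁻ t, ENNReal.ofReal (Real.exp (c * t - c ^ 2 / 2)) ∂(gaussianReal 0 1) = 1 := by
  have h := congrArg (fun κ : Measure ℝ => κ Set.univ) (gaussianReal_map_add_eq_withDensity c)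
  simp only [withDensity_apply _ MeasurableSet.univ, setLIntegral_univ] at h
  rw [Measure.map_apply (by fun_prop) MeasurableSet.univ, Set.preimage_univ, measure_univ] at h
  exact h.symm

lemma lintegral_sq_exp_mul_gaussianReal (c : ℝ) :
    ∫⁻ t, ENNReal.ofReal (Real.exp (c * t - c ^ 2 / 2)) ^ 2 ∂(gaussianReal 0 1)
      = ENNReal.ofReal (Real.exp (c ^ 2)) := by
  have : ∀ t, ENNReal.ofReal (Real.exp (c * t - c ^ 2 / 2)) ^ 2
      = ENNReal.ofReal (Real.exp (c ^ 2)) *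
        ENNReal.ofReal (Real.exp (2 * c * t - (2 * c) ^ 2 / 2)) := fun t => by
    rw [← ENNReal.ofReal_pow (by positivity), ← ENNReal.ofReal_mul (by positivity),
      ← Real.exp_nat_mul, ← Real.exp_add]
    congr 2
    push_cast
    ring
  simp_rw [this]
  rw [lintegral_const_mul _ (by fun_prop), lintegral_exp_mul_gaussianReal, mul_one]

/-- The second moment of the density of `t / s` with respect to `t` is at most `exp (D ^ 2 / 2)`,
where `D = s ^ 2 - 1`. -/
lemma lintegral_sq_scale_density_le {s : ℝ} (hs : 1 ≤ s) :
    ∫⁻ t, ENNReal.ofReal (s * Real.exp (-((s ^ 2 - 1) / 2) * t ^ 2)) ^ 2 ∂(gaussianReal 0 1)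
      ≤ ENNReal.ofReal (Real.exp ((s ^ 2 - 1) ^ 2 / 2)) := by
  set D := s ^ 2 - 1 with hD
  have hD0 : 0 ≤ D := by nlinarith
  have hs2 : s ^ 2 = 1 + D := by rw [hD]; ring
  have : ∀ t : ℝ, ENNReal.ofReal (s * Real.exp (-(D / 2) * t ^ 2)) ^ 2
      = ENNReal.ofReal (1 + D) * ENNReal.ofReal (Real.exp (-D * t ^ 2)) := fun t => by
    rw [← ENNReal.ofReal_pow (by positivity), ← ENNReal.ofReal_mul (by positivity), mul_pow, hs2,
      ← Real.exp_nat_mul]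
    congr 3
    push_cast
    ring
  simp_rw [this]
  rw [lintegral_const_mul _ (by fun_prop), lintegral_exp_sq_gaussianReal (by linarith),
    ← ENNReal.ofReal_mul (by positivity)]
  refine ENNReal.ofReal_le_ofReal ?_
  have h2 : 0 < √(1 - 2 * -D) := Real.sqrt_pos.2 (by linarith)
  rw [mul_inv_le_iff₀ h2]
  refine le_of_sq_le_sq ?_ (by positivity)
  rw [mul_pow, Real.sq_sqrt (by linarith), ← Real.exp_nat_mul]
  have := Real.add_one_le_exp ((2 : ℕ) * (D ^ 2 / 2))
  push_cast at this ⊢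
  nlinarith [pow_nonneg hD0 3, mul_nonneg hD0 (sub_nonneg.2 this)]

/-- The standard Gaussian tail bound without a leading constant: shifting by `t` multiplies the
density by at most `exp (-t² / 2)` on the half line, which has mass at most `1/2`. -/
lemma gaussianReal_tail_le {t : ℝ} (ht : 0 < t) :
    gaussianReal 0 1 {z | t < |z|} ≤ ENNReal.ofReal (Real.exp (-(t ^ 2 / 2))) := by
  set ν := gaussianReal 0 1
  have hneg : ν.map (fun z => -z) = ν := by simp [ν, gaussianReal_map_neg]
  have hrefl : ∀ s, ν (Set.Iio (-s)) = ν (Set.Ioi s) := fun s => by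
    conv_lhs => rw [← hneg]
    rw [Measure.map_apply (by fun_prop) measurableSet_Iio]
    congr 1
    ext z; simp
  have hsplit : ∀ s, 0 ≤ s → ν {z | s < |z|} = 2 * ν (Set.Ioi s) := fun s hs => by
    have : {z : ℝ | s < |z|} = Set.Ioi s ∪ Set.Iio (-s) := by
      ext z
      simp [lt_abs, lt_neg]
    rw [this, measure_union _ measurableSet_Iio, hrefl, two_mul]
    rw [Set.disjoint_left]
    intro z hz hz'
    simp only [Set.mem_Ioi, Set.mem_Iio] at hz hz'
    linarith
  have h0 : 2 * ν (Set.Ioi 0) ≤ 1 := by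
    rw [← hsplit 0 le_rfl]; exact prob_le_one
  have hshift : ν (Set.Ioi t) ≤ ENNReal.ofReal (Real.exp (-(t ^ 2 / 2))) * ν (Set.Ioi 0) := by
    have : Set.Ioi t = (fun z => z + -t) ⁻¹' Set.Ioi 0 := by ext z; simp
    rw [this, ← Measure.map_apply (by fun_prop) measurableSet_Ioi,
      gaussianReal_map_add_eq_withDensity, withDensity_apply _ measurableSet_Ioi,
      ← setLIntegral_const]
    refine setLIntegral_mono (by fun_prop) fun z hz => ?_
    refine ENNReal.ofReal_le_ofReal (Real.exp_le_exp.2 ?_)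
    simp only [Set.mem_Ioi] at hz
    nlinarith
  rw [hsplit t ht.le]
  calc 2 * ν (Set.Ioi t)
      ≤ 2 * (ENNReal.ofReal (Real.exp (-(t ^ 2 / 2))) * ν (Set.Ioi 0)) := by gcongr
    _ = ENNReal.ofReal (Real.exp (-(t ^ 2 / 2))) * (2 * ν (Set.Ioi 0)) := by ring
    _ ≤ ENNReal.ofReal (Real.exp (-(t ^ 2 / 2))) * 1 := by gcongr
    _ = _ := mul_one _

/-! ### Centred Gaussian laws -/

open Matrix in
/-- The law of `A g`, where `g` is a standard Gaussian vector: the centred Gaussian law with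
covariance matrix `A * Aᵀ`. -/
noncomputable def gaussianLaw {p : ℕ} (A : Matrix (Fin p) (Fin p) ℝ) :
    Measure (EuclideanSpace ℝ (Fin p)) :=
  (Measure.pi fun _ : Fin p => gaussianReal 0 1).map fun g => WithLp.toLp 2 (A *ᵥ g)

lemma measurable_toLp_mulVec {p : ℕ} (A : Matrix (Fin p) (Fin p) ℝ) :
    Measurable fun g : Fin p → ℝ => WithLp.toLp 2 (A.mulVec g) := by
  refine (WithLp.measurable_toLp 2 _).comp (measurable_pi_iff.2 fun i => ?_)
  simp only [Matrix.mulVec, dotProduct]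
  fun_prop

lemma gaussianLaw_eq_map_stdGaussian {p : ℕ} (A : Matrix (Fin p) (Fin p) ℝ) :
    gaussianLaw A = (stdGaussian (EuclideanSpace ℝ (Fin p))).map
      (Matrix.toEuclideanCLM (n := Fin p) (𝕜 := ℝ) A) := by
  rw [gaussianLaw, ← map_pi_eq_stdGaussian, Measure.map_map (by fun_prop)
    (WithLp.measurable_toLp 2 _)]
  rfl

/-- A linear functional of a standard Gaussian vector is distributed as its norm times a standard
Gaussian variable. -/
lemma stdGaussian_map_dual {E : Type*} [NormedAddCommGroup E] [InnerProductSpace ℝ E]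
    [FiniteDimensional ℝ E] [MeasurableSpace E] [BorelSpace E] (L : StrongDual ℝ E) :
    (stdGaussian E).map L = (gaussianReal 0 1).map fun z => ‖L‖ * z := by
  rw [IsGaussian.map_eq_gaussianReal, gaussianReal_map_const_mul, integral_strongDual_stdGaussian,
    variance_dual_stdGaussian]
  congr 1
  · simp
  · ext; simp

section

variable {p : ℕ} (A : Matrix (Fin p) (Fin p) ℝ)

instance isGaussian_gaussianLaw : IsGaussian (gaussianLaw A) := by
  rw [gaussianLaw_eq_map_stdGaussian]; infer_instance

lemma integral_gaussianLaw : ∫ x, x ∂(gaussianLaw A) = 0 := by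
  rw [gaussianLaw_eq_map_stdGaussian, integral_map (by fun_prop) (by fun_prop),
    ContinuousLinearMap.integral_comp_comm _ IsGaussian.integrable_fun_id,
    integral_id_stdGaussian, map_zero]

lemma covarianceMatrix_gaussianLaw : covarianceMatrix (gaussianLaw A) = A * A.transpose := by
  ext i j
  have h : ∀ i : Fin p, (fun x : EuclideanSpace ℝ (Fin p) => x i) =
      fun x => inner ℝ (EuclideanSpace.basisFun (Fin p) ℝ i) x := fun i => by
    ext; simp [PiLp.inner_apply]
  have hadj : (Matrix.toEuclideanCLM (n := Fin p) (𝕜 := ℝ) A).adjoint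
      = Matrix.toEuclideanCLM (n := Fin p) (𝕜 := ℝ) A.transpose := by
    rw [← ContinuousLinearMap.star_eq_adjoint, ← map_star]
    rfl
  simp only [covarianceMatrix, Matrix.of_apply]
  rw [h, h, ← covarianceBilin_apply_eq_cov IsGaussian.memLp_two_id,
    gaussianLaw_eq_map_stdGaussian, covarianceBilin_map IsGaussian.memLp_two_id,
    covarianceBilin_stdGaussian, hadj, innerSL_apply_apply]
  simp [PiLp.inner_apply, Matrix.mul_apply, mul_comm]

variable {A} {B : Matrix (Fin p) (Fin p) ℝ}

lemma isUnit_covarianceMatrix_gaussianLaw (hAB : A * B = 1) :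
    IsUnit (covarianceMatrix (gaussianLaw A)) := by
  rw [covarianceMatrix_gaussianLaw]
  have hA : IsUnit A := IsUnit.of_mul_eq_one B hAB
  exact hA.mul ((Matrix.isUnit_transpose A).2 hA)

lemma precisionMatrix_gaussianLaw (hAB : A * B = 1) :
    precisionMatrix (gaussianLaw A) = B.transpose * B := by
  have hBA : B * A = 1 := mul_eq_one_comm.1 hAB
  rw [precisionMatrix, covarianceMatrix_gaussianLaw]
  refine Matrix.inv_eq_left_inv ?_
  rw [Matrix.mul_assoc, ← Matrix.mul_assoc B, hBA, Matrix.one_mul, ← Matrix.transpose_mul, hAB,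
    Matrix.transpose_one]

/-- `1 / √ρ` dominates the standard deviation of every unit direction, so the Gaussian tail bound
with no leading constant applies. -/
lemma hasSubgaussianTails_gaussianLaw {ρ : ℝ} (hρ : 0 < ρ) (hAB : A * B = 1)
    (hB : ∀ x : Fin p → ℝ, ρ * (x ⬝ᵥ x) ≤ B.mulVec x ⬝ᵥ B.mulVec x) :
    HasSubgaussianTails ρ (gaussianLaw A) := by
  intro v hv t ht
  have hBA : B * A = 1 := mul_eq_one_comm.1 hAB
  set CA := Matrix.toEuclideanCLM (n := Fin p) (𝕜 := ℝ) A
  set L : StrongDual ℝ (EuclideanSpace ℝ (Fin p)) := (innerSL ℝ v).comp CA with hL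
  have hnorm : ∀ x : Fin p → ℝ, ‖WithLp.toLp 2 x‖ ^ 2 = x ⬝ᵥ x := fun x => by
    rw [EuclideanSpace.norm_sq_eq]
    simp [dotProduct, pow_two]
  have hCA : ∀ y, √ρ * ‖CA y‖ ≤ ‖y‖ := fun y => by
    refine le_of_sq_le_sq ?_ (norm_nonneg _)
    rw [mul_pow, Real.sq_sqrt hρ.le]
    have h := hB (A.mulVec y.ofLp)
    rw [Matrix.mulVec_mulVec, hBA, Matrix.one_mulVec, ← hnorm, ← hnorm] at h
    exact h
  have hLn : √ρ * ‖L‖ ≤ 1 := by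
    rw [← le_div_iff₀' (Real.sqrt_pos.2 hρ)]
    refine L.opNorm_le_bound (by positivity) fun y => ?_
    have h1 : ‖L y‖ ≤ ‖v‖ * ‖CA y‖ := by
      simpa [hL] using abs_real_inner_le_norm v (CA y)
    rw [hv, one_mul] at h1
    refine h1.trans ?_
    rw [div_mul_eq_mul_div, one_mul, le_div_iff₀' (Real.sqrt_pos.2 hρ)]
    exact hCA y
  have hset : ∀ s : ℝ, MeasurableSet {z : ℝ | s < |z|} := fun s =>
    measurableSet_lt measurable_const measurable_abs
  rw [integral_gaussianLaw]
  have h1 : gaussianLaw A {x | t < |inner ℝ v (x - 0)|}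
      = gaussianReal 0 1 {z | t < |‖L‖ * z|} := by
    have hm : MeasurableSet {z : ℝ | t < |z|} := hset t
    calc gaussianLaw A {x | t < |inner ℝ v (x - 0)|}
        = (stdGaussian _).map L {z | t < |z|} := by
          rw [gaussianLaw_eq_map_stdGaussian, Measure.map_apply (by fun_prop)
            (by simp only [sub_zero]; exact measurableSet_lt measurable_const (by fun_prop)),
            Measure.map_apply (by fun_prop) hm]
          simp [hL, CA]
      _ = _ := by
          rw [stdGaussian_map_dual, Measure.map_apply (by fun_prop) hm]
          rfl
  have h2 : gaussianReal 0 1 {z | t < |‖L‖ * z|}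
      ≤ ENNReal.ofReal (Real.exp (-(t ^ 2 * ρ / 2))) := by
    have h3 := gaussianReal_tail_le (t := t * √ρ) (by positivity)
    rw [mul_pow, Real.sq_sqrt hρ.le] at h3
    refine le_trans (measure_mono fun z hz => ?_) h3
    simp only [Set.mem_ofPred_eq] at hz ⊢
    rw [abs_mul, abs_norm] at hz
    calc t * √ρ < (‖L‖ * |z|) * √ρ := by gcongr
      _ = (√ρ * ‖L‖) * |z| := by ring
      _ ≤ 1 * |z| := by gcongr
      _ = |z| := one_mul _
  rw [Measure.real, h1]
  exact ENNReal.toReal_le_of_le_ofReal (Real.exp_pos _).le h2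

/-- A Gaussian law with precision matrix `Bᵀ * B` is in the class as soon as `‖B x‖² / ‖x‖²` stays
between `max ρ M₀⁻¹` and `M₀` and the precision matrix has the required decay. -/
lemma gaussianLaw_mem {α M₀ M ρ : ℝ} (hρ : 0 < ρ) (hAB : A * B = 1)
    (hB : ∀ x : Fin p → ℝ, max ρ M₀⁻¹ * (x ⬝ᵥ x) ≤ B.mulVec x ⬝ᵥ B.mulVec x)
    (hB' : ∀ x : Fin p → ℝ, B.mulVec x ⬝ᵥ B.mulVec x ≤ M₀ * (x ⬝ᵥ x))
    (hdecay : ∀ k : ℕ, 1 ≤ k → ∀ j : Fin p,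
      ∑ i ∈ Finset.univ.filter (fun i : Fin p => (k : ℤ) ≤ |((i : ℕ) : ℤ) - ((j : ℕ) : ℤ)|),
        |(B.transpose * B) i j| ≤ M * (k : ℝ) ^ (-α)) :
    gaussianLaw A ∈ {P ∈ bandablePrecisionLaws p α M₀ M ρ | ∫ x, x ∂P = 0} := by
  have hxx : ∀ x : Fin p → ℝ, 0 ≤ x ⬝ᵥ x := fun x =>
    Finset.sum_nonneg fun i _ => mul_self_nonneg _
  have hBρ : ∀ x : Fin p → ℝ, ρ * (x ⬝ᵥ x) ≤ B.mulVec x ⬝ᵥ B.mulVec x := fun x =>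
    (mul_le_mul_of_nonneg_right (le_max_left _ _) (hxx x)).trans (hB x)
  have hBM : ∀ x : Fin p → ℝ, M₀⁻¹ * (x ⬝ᵥ x) ≤ B.mulVec x ⬝ᵥ B.mulVec x := fun x =>
    (mul_le_mul_of_nonneg_right (le_max_right _ _) (hxx x)).trans (hB x)
  refine ⟨⟨inferInstance, IsGaussian.memLp_two_id, hasSubgaussianTails_gaussianLaw hρ hAB hBρ,
    isUnit_covarianceMatrix_gaussianLaw hAB, ?_⟩, integral_gaussianLaw A⟩
  rw [precisionMatrix_gaussianLaw hAB]
  refine ⟨?_, hdecay, fun l hl => ?_⟩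
  · simp [Matrix.IsSymm, Matrix.transpose_mul]
  · obtain ⟨x, hx⟩ := hl.exists_hasEigenvector
    have h1 : (B.transpose * B).mulVec x = l • x := by simpa using hx.apply_eq_smul
    have h2 : B.mulVec x ⬝ᵥ B.mulVec x = l * (x ⬝ᵥ x) := by
      have : x ⬝ᵥ (B.transpose * B).mulVec x = l * (x ⬝ᵥ x) := by
        rw [h1, dotProduct_smul, smul_eq_mul]
      rw [← this, ← Matrix.mulVec_mulVec, Matrix.dotProduct_mulVec x, Matrix.vecMul_transpose]
    have h3 : 0 < x ⬝ᵥ x :=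
      lt_of_le_of_ne (hxx x) fun h => hx.2 (dotProduct_self_eq_zero.1 h.symm)
    exact ⟨le_of_mul_le_mul_right ((hBM x).trans_eq h2) h3,
      le_of_mul_le_mul_right (h2.symm.trans_le (hB' x)) h3⟩

end

/-! ### Likelihood ratios of Gaussian laws -/

lemma lintegral_density_eq_one {X Y : Type*} [MeasurableSpace X] [MeasurableSpace Y]
    {μ : Measure X} [IsProbabilityMeasure μ] {κ : Measure Y} {h : X → Y} (hh : Measurable h)
    {l : Y → ℝ≥0∞} (hmap : μ.map h = κ.withDensity l) : ∫⁻ y, l y ∂κ = 1 := by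
  rw [← setLIntegral_univ, ← withDensity_apply _ MeasurableSet.univ, ← hmap,
    Measure.map_apply hh MeasurableSet.univ, Set.preimage_univ, measure_univ]

/-- The testing inequality for Gaussian laws: if `A' m` differs from `A` by a transformation `S m`
of the standard Gaussian vector, then `L m` is the likelihood ratio upstairs. -/
lemma half_le_testing_error_gaussianLaw {p n : ℕ} {ι : Type*} [Fintype ι] [Nonempty ι]
    {A : Matrix (Fin p) (Fin p) ℝ} {A' : ι → Matrix (Fin p) (Fin p) ℝ}
    {S : ι → (Fin p → ℝ) → (Fin p → ℝ)} {L : ι → (Fin p → ℝ) → ℝ≥0∞}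
    (hS : ∀ m, Measurable (S m)) (hL : ∀ m, Measurable (L m))
    (hA : ∀ m g, (A' m).mulVec g = A.mulVec (S m g))
    (hmap : ∀ m, (Measure.pi fun _ : Fin p => gaussianReal 0 1).map (S m)
      = (Measure.pi fun _ : Fin p => gaussianReal 0 1).withDensity (L m))
    (h2 : ∑ m, ∑ m', (∫⁻ z, L m z * L m' z ∂(Measure.pi fun _ : Fin p => gaussianReal 0 1)) ^ n
      ≤ 2 * (Fintype.card ι : ℝ≥0∞) ^ 2)
    {D : Set (Fin n → EuclideanSpace ℝ (Fin p))} (hD : MeasurableSet D) :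
    1 / 2 ≤ Measure.pi (fun _ => gaussianLaw A) D
      + (Fintype.card ι : ℝ≥0∞)⁻¹ * ∑ m, Measure.pi (fun _ => gaussianLaw (A' m)) Dᶜ := by
  have h := half_le_testing_error_pi (Measure.pi fun _ : Fin p => gaussianReal 0 1)
    (measurable_toLp_mulVec A) hL (fun m => lintegral_density_eq_one (hS m) (hmap m)) n h2 hD
  have hA' : ∀ m, gaussianLaw (A' m) = ((Measure.pi fun _ : Fin p => gaussianReal 0 1).withDensity
      (L m)).map (fun g => WithLp.toLp 2 (A.mulVec g)) := fun m => by
    rw [← hmap, Measure.map_map (measurable_toLp_mulVec A) (hS m), gaussianLaw]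
    congr 1
    funext g
    simp [hA]
  simp_rw [hA']
  exact h

/-! ### Lower bounds for the risk -/

/-- The spectral norm bounds the image of every vector; lower bounds for the loss come from testing
the error matrix on a single vector, coordinate by coordinate. -/
lemma sum_sq_mulVec_le {p : ℕ} (A : Matrix (Fin p) (Fin p) ℝ) (w : Fin p → ℝ) :
    ∑ i, A.mulVec w i ^ 2 ≤ matrixSpectralNorm A ^ 2 * ∑ i, w i ^ 2 := by
  have h := (Matrix.toEuclideanCLM (n := Fin p) (𝕜 := ℝ) A).le_opNorm (WithLp.toLp 2 w)
  have h2 := pow_le_pow_left₀ (norm_nonneg _) h 2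
  rw [mul_pow, EuclideanSpace.norm_sq_eq, EuclideanSpace.norm_sq_eq] at h2
  simpa [matrixSpectralNorm] using h2

lemma sq_apply_le_matrixSpectralNorm_sq {p : ℕ} (A : Matrix (Fin p) (Fin p) ℝ) (i : Fin p) :
    A i i ^ 2 ≤ matrixSpectralNorm A ^ 2 := by
  have h := sum_sq_mulVec_le A (Pi.single i 1)
  simp only [Matrix.mulVec_single_one, Matrix.col_apply, Pi.single_apply, ite_pow, one_pow,
    zero_pow two_ne_zero, Finset.sum_ite_eq', Finset.mem_univ, if_true, mul_one] at h
  exact (Finset.single_le_sum (f := fun j => A j i ^ 2) (fun j _ => sq_nonneg _)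
    (Finset.mem_univ i)).trans h

lemma ofReal_mul_measure_le_operatorNormRisk {n p : ℕ}
    {est : (Fin n → EuclideanSpace ℝ (Fin p)) → Matrix (Fin p) (Fin p) ℝ}
    {P : Measure (EuclideanSpace ℝ (Fin p))} {D : Set (Fin n → EuclideanSpace ℝ (Fin p))}
    (hD : MeasurableSet D) {r : ℝ}
    (h : ∀ x ∈ D, r ≤ matrixSpectralNorm (est x - precisionMatrix P) ^ 2) :
    ENNReal.ofReal r * Measure.pi (fun _ => P) D ≤ operatorNormRisk est P := by
  rw [← setLIntegral_const, operatorNormRisk]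
  refine le_trans ?_ (setLIntegral_le_lintegral D _)
  exact setLIntegral_mono' hD fun x hx => ENNReal.ofReal_le_ofReal (h x hx)

lemma inv_card_mul_sum_le {ι : Type*} [Fintype ι] [Nonempty ι] {f : ι → ℝ≥0∞} {R : ℝ≥0∞}
    (h : ∀ i, f i ≤ R) : (Fintype.card ι : ℝ≥0∞)⁻¹ * ∑ i, f i ≤ R := by
  calc (Fintype.card ι : ℝ≥0∞)⁻¹ * ∑ i, f i
      ≤ (Fintype.card ι : ℝ≥0∞)⁻¹ * ∑ _i : ι, R := by gcongr; exact h _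
    _ = R := by
      rw [Finset.sum_const, Finset.card_univ, nsmul_eq_mul, ← mul_assoc,
        ENNReal.inv_mul_cancel (by simp) (by simp), one_mul]

/-! ### Diagonal perturbations -/

section

variable {p : ℕ}

/-- The density of `t / s` with respect to `t` when `t` is a standard Gaussian variable. -/
noncomputable def scaleDensity (s t : ℝ) : ℝ≥0∞ :=
  ENNReal.ofReal (s * Real.exp (-((s ^ 2 - 1) / 2) * t ^ 2))

lemma measurable_scaleDensity (s : ℝ) : Measurable (scaleDensity s) := by
  unfold scaleDensity; fun_prop

lemma lintegral_scaleDensity {s : ℝ} (hs : 0 < s) :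
    ∫⁻ t, scaleDensity s t ∂(gaussianReal 0 1) = 1 :=
  lintegral_density_eq_one (by fun_prop) (gaussianReal_map_div_eq_withDensity hs)

lemma map_scale_pi_gaussianReal {s : ℝ} (hs : 0 < s) (m : Fin p) :
    (Measure.pi fun _ : Fin p => gaussianReal 0 1).map (fun x => Function.update x m (x m / s))
      = (Measure.pi fun _ : Fin p => gaussianReal 0 1).withDensity
        fun x => scaleDensity s (x m) :=
  map_update_pi (gaussianReal 0 1) m (h := fun _ t => t / s) (l := fun _ t => scaleDensity s t)
    (by simp only [Function.uncurry_def]; fun_prop)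
    ((measurable_scaleDensity s).comp measurable_snd) (fun _ _ => rfl) (fun _ _ => rfl)
    fun _ => gaussianReal_map_div_eq_withDensity hs

lemma lintegral_scaleDensity_mul_of_ne {s : ℝ} (hs : 0 < s) {m m' : Fin p} (hm : m ≠ m') :
    ∫⁻ x : Fin p → ℝ, scaleDensity s (x m) * scaleDensity s (x m')
      ∂(Measure.pi fun _ => gaussianReal 0 1) = 1 := by
  have h := measurable_scaleDensity s
  rw [lintegral_pi_update (gaussianReal 0 1) m (by fun_prop)]
  simp only [Function.update_self, Function.update_of_ne hm.symm]
  simp_rw [lintegral_mul_const _ h, lintegral_scaleDensity hs, one_mul]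
  rw [(measurePreserving_eval (fun _ : Fin p => gaussianReal 0 1) m').lintegral_comp h,
    lintegral_scaleDensity hs]

lemma lintegral_scaleDensity_mul_self_le {s : ℝ} (hs : 1 ≤ s) (m : Fin p) :
    ∫⁻ x : Fin p → ℝ, scaleDensity s (x m) * scaleDensity s (x m)
      ∂(Measure.pi fun _ => gaussianReal 0 1) ≤ ENNReal.ofReal (Real.exp ((s ^ 2 - 1) ^ 2 / 2)) := by
  have h := measurable_scaleDensity s
  rw [(measurePreserving_eval (fun _ : Fin p => gaussianReal 0 1) m).lintegral_comp
    (f := fun t => scaleDensity s t * scaleDensity s t) (by fun_prop)]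
  simp_rw [← pow_two]
  exact lintegral_sq_scale_density_le hs

/-- The diagonal matrix with `s` in position `m` and `1` elsewhere. -/
def spikeMatrix (s : ℝ) (m : Fin p) : Matrix (Fin p) (Fin p) ℝ :=
  Matrix.diagonal (Function.update 1 m s)

lemma spikeMatrix_mulVec (s : ℝ) (m : Fin p) (x : Fin p → ℝ) :
    (spikeMatrix s m).mulVec x = Function.update x m (s * x m) := by
  ext i
  by_cases hi : i = m
  · subst hi; simp [spikeMatrix, Matrix.mulVec_diagonal]
  · simp [spikeMatrix, Matrix.mulVec_diagonal, hi]

lemma spikeMatrix_inv_mul {s : ℝ} (hs : s ≠ 0) (m : Fin p) :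
    spikeMatrix s⁻¹ m * spikeMatrix s m = 1 := by
  rw [spikeMatrix, spikeMatrix, Matrix.diagonal_mul_diagonal, ← Matrix.diagonal_one]
  congr 1
  ext i
  by_cases hi : i = m
  · subst hi; simp [hs]
  · simp [hi]

lemma spikeMatrix_one (m : Fin p) : spikeMatrix 1 m = 1 := by
  rw [spikeMatrix, ← Matrix.diagonal_one]
  congr 1
  exact Function.update_eq_self m 1

lemma spike_gram (a s : ℝ) (ha : 0 ≤ a) (m : Fin p) :
    (√a • spikeMatrix s m).transpose * (√a • spikeMatrix s m)
      = Matrix.diagonal (fun i => a * Function.update (1 : Fin p → ℝ) m s i ^ 2) := by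
  rw [Matrix.transpose_smul, spikeMatrix, Matrix.diagonal_transpose, Matrix.smul_mul,
    Matrix.mul_smul, smul_smul, Matrix.diagonal_mul_diagonal, Real.mul_self_sqrt ha,
    ← Matrix.diagonal_smul]
  congr 1
  ext i
  simp [pow_two]

lemma inv_sqrt_smul_mul {a : ℝ} (ha : 0 < a) {A B : Matrix (Fin p) (Fin p) ℝ} (h : A * B = 1) :
    ((√a)⁻¹ • A) * (√a • B) = 1 := by
  rw [Matrix.smul_mul, Matrix.mul_smul, smul_smul, h,
    inv_mul_cancel₀ (Real.sqrt_pos.2 ha).ne', one_smul]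

lemma gaussianLaw_spike_mem {a s α M₀ M ρ : ℝ} (hρ : 0 < ρ) (hM : 0 < M) (ha : 0 < a)
    (hs : 1 ≤ s) (h1 : max ρ M₀⁻¹ ≤ a) (h2 : a * s ^ 2 ≤ M₀) (m : Fin p) :
    gaussianLaw ((√a)⁻¹ • spikeMatrix s⁻¹ m) ∈
      {P ∈ bandablePrecisionLaws p α M₀ M ρ | ∫ x, x ∂P = 0} := by
  have hs0 : 0 < s := by linarith
  have hv : ∀ i, 1 ≤ Function.update (1 : Fin p → ℝ) m s i ^ 2 ∧
      Function.update (1 : Fin p → ℝ) m s i ^ 2 ≤ s ^ 2 := fun i => by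
    have hs2 : 1 ≤ s ^ 2 := one_le_pow₀ hs
    by_cases hi : i = m
    · subst hi; simp only [Function.update_self, hs2, le_refl, and_self]
    · simp only [Function.update_of_ne hi, Pi.one_apply, one_pow, hs2, le_refl, and_self]
  have hnorm : ∀ x : Fin p → ℝ, (√a • spikeMatrix s m).mulVec x ⬝ᵥ (√a • spikeMatrix s m).mulVec x
      = ∑ i, a * Function.update (1 : Fin p → ℝ) m s i ^ 2 * (x i * x i) := fun x => by
    refine Finset.sum_congr rfl fun i _ => ?_
    have : (√a • spikeMatrix s m).mulVec x i = √a * (Function.update (1 : Fin p → ℝ) m s i * x i) := by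
      rw [Matrix.smul_mulVec]; simp [spikeMatrix, Matrix.mulVec_diagonal]
    rw [this]
    linear_combination (Function.update (1 : Fin p → ℝ) m s i * x i) ^ 2 * Real.mul_self_sqrt ha.le
  refine gaussianLaw_mem hρ (inv_sqrt_smul_mul ha (spikeMatrix_inv_mul hs0.ne' m)) ?_ ?_ ?_
  · intro x
    rw [hnorm, dotProduct, Finset.mul_sum]
    refine Finset.sum_le_sum fun i _ => mul_le_mul_of_nonneg_right ?_ (mul_self_nonneg _)
    nlinarith [(hv i).1]
  · intro x
    rw [hnorm, dotProduct, Finset.mul_sum]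
    refine Finset.sum_le_sum fun i _ => mul_le_mul_of_nonneg_right ?_ (mul_self_nonneg _)
    nlinarith [(hv i).2]
  · intro k hk j
    rw [spike_gram a s ha.le]
    refine le_trans (le_of_eq (Finset.sum_eq_zero fun i hi => ?_)) (by positivity)
    have hij : i ≠ j := by
      rintro rfl
      simp only [Finset.mem_filter, sub_self, abs_zero] at hi
      omega
    rw [Matrix.diagonal_apply_ne _ hij, abs_zero]

/-- Raising one unknown diagonal entry of the precision matrix from `a` to `a * s ^ 2` is not
detectable as long as `n (s ^ 2 - 1) ^ 2 / 2 ≤ log p`: the second moment of the likelihood ratio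
of the mixture over the `p` positions stays below `2`. -/
lemma le_minimaxRisk_of_spikes {n : ℕ} {a s α M₀ M ρ : ℝ} (hp : 0 < p) (hρ : 0 < ρ) (hM : 0 < M)
    (ha : 0 < a) (hs : 1 ≤ s) (h1 : max ρ M₀⁻¹ ≤ a) (h2 : a * s ^ 2 ≤ M₀)
    (hn : n * ((s ^ 2 - 1) ^ 2 / 2) ≤ Real.log p) :
    ENNReal.ofReal (a ^ 2 * (s ^ 2 - 1) ^ 2 / 16) ≤
      operatorNormMinimaxRisk n {P ∈ bandablePrecisionLaws p α M₀ M ρ | ∫ x, x ∂P = 0} := by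
  have hs0 : 0 < s := by linarith
  have : Nonempty (Fin p) := ⟨⟨0, hp⟩⟩
  have m₀ : Fin p := ⟨0, hp⟩
  refine le_iInf₂ fun est hest => ?_
  set C := {P ∈ bandablePrecisionLaws p α M₀ M ρ | ∫ x, x ∂P = 0}
  set R := ⨆ P ∈ C, operatorNormRisk est P
  -- The test compares the largest diagonal entry with the midpoint of `a` and `a * s ^ 2`.
  set D : Set (Fin n → EuclideanSpace ℝ (Fin p)) :=
    ⋃ m, {x | a + a * (s ^ 2 - 1) / 2 ≤ est x m m} with hD
  have hDm : MeasurableSet D :=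
    MeasurableSet.iUnion fun m => measurableSet_le measurable_const (hest m m)
  have htest := half_le_testing_error_gaussianLaw (n := n) (A := (√a)⁻¹ • (1 : Matrix (Fin p) _ ℝ))
    (A' := fun m => (√a)⁻¹ • spikeMatrix s⁻¹ m) (S := fun m x => Function.update x m (x m / s))
    (L := fun m x => scaleDensity s (x m)) ?_ ?_ ?_ (fun m => map_scale_pi_gaussianReal hs0 m) ?_ hDm
  · have hprec : ∀ s' : ℝ, 0 < s' → ∀ m : Fin p,
        precisionMatrix (gaussianLaw ((√a)⁻¹ • spikeMatrix s'⁻¹ m))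
          = Matrix.diagonal (fun i => a * Function.update (1 : Fin p → ℝ) m s' i ^ 2) :=
      fun s' hs' m => by
        rw [precisionMatrix_gaussianLaw (inv_sqrt_smul_mul ha (spikeMatrix_inv_mul hs'.ne' m)),
          spike_gram a s' ha.le]
    have hr0 : ENNReal.ofReal ((a * (s ^ 2 - 1) / 2) ^ 2) *
        Measure.pi (fun _ => gaussianLaw ((√a)⁻¹ • (1 : Matrix (Fin p) _ ℝ))) D ≤ R := by
      -- The unperturbed law is the case `s = 1` of the spiked ones.
      have hone : (√a)⁻¹ • (1 : Matrix (Fin p) _ ℝ) = (√a)⁻¹ • spikeMatrix 1⁻¹ m₀ := by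
        rw [inv_one, spikeMatrix_one]
      rw [hone]
      refine le_trans (ofReal_mul_measure_le_operatorNormRisk hDm fun x hx => ?_)
        (le_iSup₂_of_le _ (gaussianLaw_spike_mem hρ hM ha le_rfl h1 (le_trans (mul_le_mul_of_nonneg_left
          (by rw [one_pow]; exact one_le_pow₀ hs) ha.le) h2) m₀) le_rfl)
      rw [hprec 1 one_pos]
      obtain ⟨m, hm⟩ := Set.mem_iUnion.1 hx
      simp only [Set.mem_ofPred_eq] at hm
      refine le_trans ?_ (sq_apply_le_matrixSpectralNorm_sq _ m)
      rw [Matrix.sub_apply, Matrix.diagonal_apply_eq,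
        show Function.update (1 : Fin p → ℝ) m₀ 1 = 1 from Function.update_eq_self m₀ 1]
      have : 0 ≤ a * (s ^ 2 - 1) := mul_nonneg ha.le (by nlinarith)
      refine pow_le_pow_left₀ (by linarith) ?_ 2
      simp only [Pi.one_apply]
      linarith
    have hr1 : ∀ m, ENNReal.ofReal ((a * (s ^ 2 - 1) / 2) ^ 2) *
        Measure.pi (fun _ => gaussianLaw ((√a)⁻¹ • spikeMatrix s⁻¹ m)) Dᶜ ≤ R := fun m => by
      refine le_trans (ofReal_mul_measure_le_operatorNormRisk hDm.compl fun x hx => ?_)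
        (le_iSup₂_of_le _ (gaussianLaw_spike_mem hρ hM ha hs h1 h2 m) le_rfl)
      rw [hprec s hs0]
      have hm : est x m m < a + a * (s ^ 2 - 1) / 2 := by
        by_contra hcon
        exact hx (Set.mem_iUnion.2 ⟨m, not_lt.1 hcon⟩)
      refine le_trans ?_ (sq_apply_le_matrixSpectralNorm_sq _ m)
      rw [Matrix.sub_apply, Matrix.diagonal_apply_eq, Function.update_self]
      have : 0 ≤ a * (s ^ 2 - 1) := mul_nonneg ha.le (by nlinarith)
      rw [← neg_sq (est x m m - _)]
      refine pow_le_pow_left₀ (by linarith) ?_ 2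
      linarith
    have hsum : ENNReal.ofReal ((a * (s ^ 2 - 1) / 2) ^ 2) * (1 / 2) ≤ R + R := by
      refine (mul_le_mul_right htest _).trans ?_
      rw [mul_add, mul_left_comm, Finset.mul_sum]
      exact add_le_add hr0 (inv_card_mul_sum_le hr1)
    rw [← two_mul, mul_comm, one_div, ENNReal.inv_mul_le_iff (by simp) (by simp), ← mul_assoc] at hsum
    rw [show a ^ 2 * (s ^ 2 - 1) ^ 2 / 16 = (a * (s ^ 2 - 1) / 2) ^ 2 / 4 by ring,
      ENNReal.ofReal_div_of_pos (by norm_num)]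
    refine ENNReal.div_le_of_le_mul' ?_
    convert hsum using 2
    norm_num
  · intro m
    exact (measurable_update' (a := m)).comp
      (measurable_id.prodMk (Measurable.div_const (by fun_prop : Measurable fun x : Fin p → ℝ => x m) s))
  · exact fun m => (measurable_scaleDensity s).comp (measurable_pi_apply m)
  · intro m g
    rw [Matrix.smul_mulVec, Matrix.smul_mulVec, spikeMatrix_mulVec, Matrix.one_mulVec,
      inv_mul_eq_div]
  · have hexp : Real.exp ((s ^ 2 - 1) ^ 2 / 2) ^ n ≤ p := by
      rw [← Real.exp_nat_mul, ← Real.le_log_iff_exp_le (by exact_mod_cast hp)]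
      exact hn
    have hterm : ∀ m m' : Fin p, (∫⁻ x : Fin p → ℝ, scaleDensity s (x m) * scaleDensity s (x m')
        ∂(Measure.pi fun _ => gaussianReal 0 1)) ^ n ≤ (if m = m' then (p : ℝ≥0∞) else 0) + 1 := by
      intro m m'
      by_cases hm : m = m'
      · subst hm
        simp only [if_true]
        refine le_trans (pow_le_pow_left₀ zero_le (lintegral_scaleDensity_mul_self_le hs m) n) ?_
        rw [← ENNReal.ofReal_pow (Real.exp_pos _).le]
        refine (ENNReal.ofReal_le_ofReal hexp).trans ?_
        rw [ENNReal.ofReal_natCast]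
        exact le_self_add
      · rw [lintegral_scaleDensity_mul_of_ne hs0 hm, one_pow]
        exact le_add_self
    calc _ ≤ ∑ m : Fin p, ∑ m' : Fin p, ((if m = m' then (p : ℝ≥0∞) else 0) + 1) :=
          Finset.sum_le_sum fun m _ => Finset.sum_le_sum fun m' _ => hterm m m'
      _ = 2 * (Fintype.card (Fin p) : ℝ≥0∞) ^ 2 := by
          simp [Finset.sum_add_distrib]
          ring

end

/-! ### Shear perturbations -/

section

variable {p : ℕ}

lemma map_dotProduct_pi_gaussianReal (w : Fin p → ℝ) :
    (Measure.pi fun _ : Fin p => gaussianReal 0 1).map (fun x => w ⬝ᵥ x)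
      = (gaussianReal 0 1).map fun z => √(w ⬝ᵥ w) * z := by
  have h := stdGaussian_map_dual (innerSL ℝ (WithLp.toLp 2 w : EuclideanSpace ℝ (Fin p)))
  rw [← map_pi_eq_stdGaussian, Measure.map_map (by fun_prop) (WithLp.measurable_toLp 2 _),
    innerSL_apply_norm, EuclideanSpace.norm_eq] at h
  convert h using 3
  · simp [PiLp.inner_apply, dotProduct, mul_comm]
  · simp [dotProduct, pow_two]

lemma dotProduct_update_of_eq_zero {w : Fin p → ℝ} {i : Fin p} (hw : w i = 0) (x : Fin p → ℝ)
    (t : ℝ) : w ⬝ᵥ Function.update x i t = w ⬝ᵥ x := by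
  refine Finset.sum_congr rfl fun j _ => ?_
  by_cases hj : j = i
  · subst hj; simp [hw]
  · simp [hj]

/-- The density of the standard Gaussian vector after its `i`-th coordinate has been increased by
`c * (w ⬝ᵥ x)`, where `w i = 0`. -/
noncomputable def shearDensity (w : Fin p → ℝ) (c : ℝ) (i : Fin p) (x : Fin p → ℝ) : ℝ≥0∞ :=
  ENNReal.ofReal (Real.exp (c * (w ⬝ᵥ x) * x i - (c * (w ⬝ᵥ x)) ^ 2 / 2))

lemma measurable_dotProduct_left (w : Fin p → ℝ) : Measurable fun x : Fin p → ℝ => w ⬝ᵥ x := by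
  simp only [dotProduct]; fun_prop

lemma measurable_shearDensity (w : Fin p → ℝ) (c : ℝ) (i : Fin p) :
    Measurable (shearDensity w c i) := by
  have := measurable_dotProduct_left w
  unfold shearDensity
  fun_prop

lemma map_shear_pi_gaussianReal {w : Fin p → ℝ} {i : Fin p} (hw : w i = 0) (c : ℝ) :
    (Measure.pi fun _ : Fin p => gaussianReal 0 1).map
        (fun x => Function.update x i (x i + c * (w ⬝ᵥ x)))
      = (Measure.pi fun _ : Fin p => gaussianReal 0 1).withDensity (shearDensity w c i) := by
  have hm := measurable_dotProduct_left w
  refine map_update_pi (gaussianReal 0 1) i (h := fun x t => t + c * (w ⬝ᵥ x))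
    (l := fun x t => ENNReal.ofReal (Real.exp (c * (w ⬝ᵥ x) * t - (c * (w ⬝ᵥ x)) ^ 2 / 2)))
    ?_ ?_ ?_ ?_ fun x => gaussianReal_map_add_eq_withDensity _
  · simp only [Function.uncurry_def]; fun_prop
  · simp only [Function.uncurry_def]; fun_prop
  · intro x t; simp only [dotProduct_update_of_eq_zero hw]
  · intro x t; simp only [dotProduct_update_of_eq_zero hw]

lemma lintegral_shearDensity_mul_self_le {w : Fin p → ℝ} {i : Fin p} (hw : w i = 0) {c : ℝ}
    (hc : c ^ 2 * (w ⬝ᵥ w) ≤ 1 / 4) :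
    ∫⁻ x, shearDensity w c i x * shearDensity w c i x
        ∂(Measure.pi fun _ : Fin p => gaussianReal 0 1)
      ≤ ENNReal.ofReal (Real.exp (2 * (c ^ 2 * (w ⬝ᵥ w)))) := by
  have hm := measurable_dotProduct_left w
  have hs := measurable_shearDensity w c i
  have hww : 0 ≤ w ⬝ᵥ w := Finset.sum_nonneg fun i _ => mul_self_nonneg _
  rw [lintegral_pi_update (gaussianReal 0 1) i (by fun_prop)]
  have h1 : ∀ x : Fin p → ℝ, ∫⁻ t, shearDensity w c i (Function.update x i t)
      * shearDensity w c i (Function.update x i t) ∂(gaussianReal 0 1)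
      = ENNReal.ofReal (Real.exp (c ^ 2 * (w ⬝ᵥ x) ^ 2)) := fun x => by
    simp only [shearDensity, dotProduct_update_of_eq_zero hw, Function.update_self, ← pow_two]
    rw [lintegral_sq_exp_mul_gaussianReal, mul_pow]
  simp_rw [h1]
  have h2 : Measurable fun z : ℝ => ENNReal.ofReal (Real.exp (c ^ 2 * z ^ 2)) := by fun_prop
  rw [← lintegral_map h2 hm, map_dotProduct_pi_gaussianReal, lintegral_map h2 (by fun_prop)]
  simp_rw [mul_pow, Real.sq_sqrt hww, ← mul_assoc (c ^ 2)]
  exact lintegral_exp_sq_gaussianReal_le (by positivity) hc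

/-- The indicator of the second block `[k, 2k)` of coordinates. -/
def blockVector (p k : ℕ) (j : Fin p) : ℝ := if k ≤ (j : ℕ) ∧ (j : ℕ) < 2 * k then 1 else 0

/-- The vector of signs `θ` on the first block `[0, k)` of coordinates, and `0` elsewhere. -/
def signVector (k : ℕ) (θ : Fin p → ℤˣ) (i : Fin p) : ℝ := if (i : ℕ) < k then ((θ i : ℤ) : ℝ) else 0

lemma sum_ite_fin (k l : ℕ) (hl : l ≤ p) :
    ∑ j : Fin p, (if k ≤ (j : ℕ) ∧ (j : ℕ) < l then (1 : ℝ) else 0) = (l - k : ℕ) := by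
  rw [Fin.sum_univ_eq_sum_range (fun j => if k ≤ j ∧ j < l then (1 : ℝ) else 0) p,
    Finset.sum_boole, ← Nat.card_Ico]
  congr 2
  ext j
  simp only [Finset.mem_filter, Finset.mem_range, Finset.mem_Ico]
  omega

lemma unit_mul_self_cast (z : ℤˣ) : ((z : ℤ) : ℝ) * ((z : ℤ) : ℝ) = 1 := by
  rcases Int.units_eq_one_or z with h | h <;> simp [h]

variable {k : ℕ}

lemma blockVector_dotProduct_self (hk : 2 * k ≤ p) :
    blockVector p k ⬝ᵥ blockVector p k = k := by
  have h := sum_ite_fin k (2 * k) hk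
  rw [show 2 * k - k = k by omega] at h
  rw [← h]
  exact Finset.sum_congr rfl fun j _ => by simp [blockVector]

lemma signVector_dotProduct_self (hk : 2 * k ≤ p) (θ : Fin p → ℤˣ) :
    signVector k θ ⬝ᵥ signVector k θ = k := by
  have h := sum_ite_fin (p := p) 0 k (by omega)
  rw [Nat.sub_zero] at h
  rw [← h]
  refine Finset.sum_congr rfl fun j _ => ?_
  by_cases hj : (j : ℕ) < k <;> simp [signVector, hj, unit_mul_self_cast]

lemma blockVector_dotProduct_signVector (θ : Fin p → ℤˣ) :
    blockVector p k ⬝ᵥ signVector k θ = 0 := by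
  refine Finset.sum_eq_zero fun j _ => ?_
  by_cases hj : (j : ℕ) < k
  · simp [blockVector, not_le.2 hj]
  · simp [signVector, hj]

/-- The unipotent matrix `1 + e u_θ wᵀ`, with `u_θ` the sign vector on the first block and `w` the
indicator of the second block. -/
def shearMatrix (k : ℕ) (e : ℝ) (θ : Fin p → ℤˣ) : Matrix (Fin p) (Fin p) ℝ :=
  1 + e • Matrix.vecMulVec (signVector k θ) (blockVector p k)

lemma shearMatrix_mulVec (e : ℝ) (θ : Fin p → ℤˣ) (x : Fin p → ℝ) :
    (shearMatrix k e θ).mulVec x = x + (e * (blockVector p k ⬝ᵥ x)) • signVector k θ := by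
  ext i
  simp [shearMatrix, Matrix.add_mulVec, Matrix.smul_mulVec, Matrix.vecMulVec_mulVec]
  ring

lemma shearMatrix_neg_mul (e : ℝ) (θ : Fin p → ℤˣ) :
    shearMatrix k (-e) θ * shearMatrix k e θ = 1 := by
  simp [shearMatrix, add_mul, mul_add, Matrix.vecMulVec_mul_vecMulVec,
    blockVector_dotProduct_signVector]

lemma shear_gram_apply (hk : 2 * k ≤ p) (a e : ℝ) (ha : 0 ≤ a) (θ : Fin p → ℤˣ) (i j : Fin p) :
    ((√a • shearMatrix k e θ).transpose * (√a • shearMatrix k e θ)) i j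
      = a * ((1 : Matrix (Fin p) (Fin p) ℝ) i j
        + e * (signVector k θ i * blockVector p k j + blockVector p k i * signVector k θ j)
        + e ^ 2 * k * (blockVector p k i * blockVector p k j)) := by
  rw [Matrix.transpose_smul, Matrix.smul_mul, Matrix.mul_smul, smul_smul, Real.mul_self_sqrt ha,
    shearMatrix, Matrix.transpose_add, Matrix.transpose_smul, Matrix.transpose_vecMulVec,
    Matrix.transpose_one, add_mul, mul_add, mul_add, Matrix.smul_mul, Matrix.mul_smul,
    Matrix.smul_mul, Matrix.mul_smul, Matrix.vecMulVec_mul_vecMulVec, signVector_dotProduct_self hk]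
  simp [Matrix.vecMulVec_apply]
  left
  ring

lemma shear_gram_mulVec_blockVector (hk : 2 * k ≤ p) (a e : ℝ) (ha : 0 ≤ a) (θ : Fin p → ℤˣ)
    {i : Fin p} (hi : (i : ℕ) < k) :
    ((√a • shearMatrix k e θ).transpose * (√a • shearMatrix k e θ)).mulVec (blockVector p k) i
      = a * e * k * ((θ i : ℤ) : ℝ) := by
  have hw : blockVector p k i = 0 := by simp [blockVector, not_le.2 hi]
  have hu : signVector k θ i = ((θ i : ℤ) : ℝ) := by simp [signVector, hi]
  have hone : ∑ j, (1 : Matrix (Fin p) (Fin p) ℝ) i j * blockVector p k j = 0 := by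
    have := congrFun (Matrix.one_mulVec (blockVector p k)) i
    rwa [hw] at this
  have hww : ∑ j, blockVector p k j * blockVector p k j = k := blockVector_dotProduct_self hk
  simp only [Matrix.mulVec, dotProduct, shear_gram_apply hk a e ha, hw, hu]
  calc _ = a * ∑ j, (1 : Matrix (Fin p) (Fin p) ℝ) i j * blockVector p k j
        + a * e * ((θ i : ℤ) : ℝ) * ∑ j, blockVector p k j * blockVector p k j := by
        rw [Finset.mul_sum, Finset.mul_sum, ← Finset.sum_add_distrib]
        exact Finset.sum_congr rfl fun j _ => by ring
    _ = _ := by rw [hone, hww]; ring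

/-- The precision matrix is diagonal outside the first `2 k` coordinates, where its entries are at
most `3 a e`; hence only distances below `2 k` matter, and there a column sum is at most
`6 a e k`. -/
lemma shear_decay {a e α M : ℝ} (hk1 : 1 ≤ k) (hk : 2 * k ≤ p) (hα : 0 < α) (hM : 0 < M)
    (ha : 0 < a) (he : 0 ≤ e)
    (hek : e * k ≤ 1) (hdec : 6 * a * (e * k) ≤ M * ((2 * k : ℕ) : ℝ) ^ (-α)) (θ : Fin p → ℤˣ)
    (l : ℕ) (hl : 1 ≤ l) (j : Fin p) :
    ∑ i ∈ Finset.univ.filter (fun i : Fin p => (l : ℤ) ≤ |((i : ℕ) : ℤ) - ((j : ℕ) : ℤ)|),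
      |((√a • shearMatrix k e θ).transpose * (√a • shearMatrix k e θ)) i j|
        ≤ M * (l : ℝ) ^ (-α) := by
  have hw0 : ∀ i : Fin p, ¬ (i : ℕ) < 2 * k → blockVector p k i = 0 := fun i hi => by
    simp [blockVector, hi]
  have hu0 : ∀ i : Fin p, ¬ (i : ℕ) < 2 * k → signVector k θ i = 0 := fun i hi => by
    simp only [signVector, if_neg (show ¬ (i : ℕ) < k by omega)]
  have hwb : ∀ i : Fin p, |blockVector p k i| ≤ 1 := fun i => by
    unfold blockVector; split_ifs <;> simp
  have hub : ∀ i : Fin p, |signVector k θ i| ≤ 1 := fun i => by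
    unfold signVector
    split_ifs
    · rcases Int.units_eq_one_or (θ i) with h | h <;> simp [h]
    · simp
  have hne : ∀ i : Fin p, (l : ℤ) ≤ |((i : ℕ) : ℤ) - ((j : ℕ) : ℤ)| → i ≠ j := by
    rintro i hi rfl
    simp only [sub_self, abs_zero] at hi
    omega
  by_cases hl2 : l < 2 * k
  · have hterm : ∀ i : Fin p, (l : ℤ) ≤ |((i : ℕ) : ℤ) - ((j : ℕ) : ℤ)| →
        |((√a • shearMatrix k e θ).transpose * (√a • shearMatrix k e θ)) i j|
          ≤ 3 * a * e * (if 0 ≤ (i : ℕ) ∧ (i : ℕ) < 2 * k then 1 else 0) := by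
      intro i hi
      rw [shear_gram_apply hk a e ha.le, Matrix.one_apply_ne (hne i hi)]
      by_cases hi2 : (i : ℕ) < 2 * k
      · simp only [Nat.zero_le, hi2, and_self, if_true, mul_one, zero_add]
        rw [abs_mul, abs_of_pos ha, mul_comm 3 a, mul_assoc a 3 e]
        refine mul_le_mul_of_nonneg_left ?_ ha.le
        have b1 : ∀ {x y : ℝ}, |x| ≤ 1 → |y| ≤ 1 → |x * y| ≤ 1 := fun hx hy => by
          rw [abs_mul]; exact mul_le_one₀ hx (abs_nonneg _) hy
        have h1 := abs_le.1 (b1 (hub i) (hwb j))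
        have h2 := abs_le.1 (b1 (hwb i) (hub j))
        have h3 := abs_le.1 (b1 (hwb i) (hwb j))
        have h4 : 0 ≤ e ^ 2 * k := by positivity
        have h5 : e ^ 2 * k ≤ e := by nlinarith
        rw [abs_le]
        constructor
        · nlinarith [mul_le_mul_of_nonneg_left h1.1 he, mul_le_mul_of_nonneg_left h2.1 he,
            mul_le_mul_of_nonneg_left h3.1 h4]
        · nlinarith [mul_le_mul_of_nonneg_left h1.2 he, mul_le_mul_of_nonneg_left h2.2 he,
            mul_le_mul_of_nonneg_left h3.2 h4]
      · simp [hw0 i hi2, hu0 i hi2, hi2]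
    calc _ ≤ ∑ i ∈ Finset.univ.filter
            (fun i : Fin p => (l : ℤ) ≤ |((i : ℕ) : ℤ) - ((j : ℕ) : ℤ)|),
            3 * a * e * (if 0 ≤ (i : ℕ) ∧ (i : ℕ) < 2 * k then 1 else 0) :=
          Finset.sum_le_sum fun i hi => hterm i (Finset.mem_filter.1 hi).2
      _ ≤ ∑ i : Fin p, 3 * a * e * (if 0 ≤ (i : ℕ) ∧ (i : ℕ) < 2 * k then 1 else 0) :=
          Finset.sum_le_sum_of_subset_of_nonneg (Finset.filter_subset _ _) fun i _ _ => by
            positivity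
      _ = 6 * a * (e * k) := by
          rw [← Finset.mul_sum, sum_ite_fin 0 (2 * k) hk, Nat.sub_zero]
          push_cast
          ring
      _ ≤ M * ((2 * k : ℕ) : ℝ) ^ (-α) := hdec
      _ ≤ M * (l : ℝ) ^ (-α) := by
          refine mul_le_mul_of_nonneg_left ?_ hM.le
          refine Real.rpow_le_rpow_of_nonpos (by exact_mod_cast hl) (by exact_mod_cast hl2.le)
            (by linarith)
  · refine le_trans (le_of_eq (Finset.sum_eq_zero fun i hi => ?_)) (by positivity)
    have hi' := (Finset.mem_filter.1 hi).2
    rw [shear_gram_apply hk a e ha.le, Matrix.one_apply_ne (hne i hi')]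
    have : ¬ (i : ℕ) < 2 * k ∨ ¬ (j : ℕ) < 2 * k := by
      by_contra hcon
      rw [le_abs] at hi'
      omega
    rcases this with h | h <;> simp [hw0 _ h, hu0 _ h]

lemma gaussianLaw_shear_mem {a e α M₀ M ρ : ℝ} (hk1 : 1 ≤ k) (hk : 2 * k ≤ p) (hα : 0 < α)
    (hρ : 0 < ρ) (hM : 0 < M) (ha : 0 < a) (he : 0 ≤ e) (hek : e * k ≤ 1)
    (h1 : max ρ M₀⁻¹ ≤ a * (1 - 2 * (e * k))) (h2 : a * (1 + e * k) ^ 2 ≤ M₀)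
    (hdec : 6 * a * (e * k) ≤ M * ((2 * k : ℕ) : ℝ) ^ (-α)) (θ : Fin p → ℤˣ) :
    gaussianLaw ((√a)⁻¹ • shearMatrix k (-e) θ) ∈
      {P ∈ bandablePrecisionLaws p α M₀ M ρ | ∫ x, x ∂P = 0} := by
  set u := signVector k θ with hu
  set w := blockVector p k with hw
  have hxx : ∀ x : Fin p → ℝ, 0 ≤ x ⬝ᵥ x := fun x =>
    Finset.sum_nonneg fun i _ => mul_self_nonneg _
  have hnorm : ∀ x : Fin p → ℝ, (√a • shearMatrix k e θ).mulVec x ⬝ᵥ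
      (√a • shearMatrix k e θ).mulVec x
      = a * (x ⬝ᵥ x + 2 * e * ((w ⬝ᵥ x) * (u ⬝ᵥ x)) + e ^ 2 * k * (w ⬝ᵥ x) ^ 2) := fun x => by
    rw [Matrix.smul_mulVec, smul_dotProduct, dotProduct_smul, smul_smul, Real.mul_self_sqrt ha.le,
      smul_eq_mul, shearMatrix_mulVec, add_dotProduct, dotProduct_add, dotProduct_add,
      smul_dotProduct, dotProduct_smul, dotProduct_smul, smul_dotProduct,
      signVector_dotProduct_self hk, dotProduct_comm x (signVector k θ)]
    simp only [smul_eq_mul]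
    ring
  have hcs : ∀ x y : Fin p → ℝ, (y ⬝ᵥ x) ^ 2 ≤ (y ⬝ᵥ y) * (x ⬝ᵥ x) := fun x y => by
    simp only [dotProduct, ← pow_two]
    exact Finset.sum_mul_sq_le_sq_mul_sq _ _ _
  have hwx : ∀ x : Fin p → ℝ, (w ⬝ᵥ x) ^ 2 ≤ k * (x ⬝ᵥ x) := fun x => by
    simpa [hw, blockVector_dotProduct_self hk] using hcs x w
  have hux : ∀ x : Fin p → ℝ, (u ⬝ᵥ x) ^ 2 ≤ k * (x ⬝ᵥ x) := fun x => by
    simpa [hu, signVector_dotProduct_self hk] using hcs x u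
  have hprod : ∀ x : Fin p → ℝ, |(w ⬝ᵥ x) * (u ⬝ᵥ x)| ≤ k * (x ⬝ᵥ x) := fun x => by
    rw [abs_le]
    constructor <;> nlinarith [hwx x, hux x, sq_nonneg (w ⬝ᵥ x + u ⬝ᵥ x),
      sq_nonneg (w ⬝ᵥ x - u ⬝ᵥ x)]
  refine gaussianLaw_mem hρ (inv_sqrt_smul_mul ha (shearMatrix_neg_mul e θ)) ?_ ?_
    (shear_decay hk1 hk hα hM ha he hek hdec θ)
  · intro x
    rw [hnorm]
    refine (mul_le_mul_of_nonneg_right h1 (hxx x)).trans ?_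
    rw [mul_assoc]
    refine mul_le_mul_of_nonneg_left ?_ ha.le
    have h3 := mul_le_mul_of_nonneg_left (abs_le.1 (hprod x)).1 he
    have h4 : 0 ≤ e ^ 2 * k * (w ⬝ᵥ x) ^ 2 := by positivity
    linarith
  · intro x
    rw [hnorm]
    refine le_trans ?_ (mul_le_mul_of_nonneg_right h2 (hxx x))
    rw [mul_assoc a]
    refine mul_le_mul_of_nonneg_left ?_ ha.le
    have h3 := mul_le_mul_of_nonneg_left (abs_le.1 (hprod x)).2 he
    have h4 := mul_le_mul_of_nonneg_left (hwx x) (by positivity : 0 ≤ e ^ 2 * k)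
    linarith

lemma signVector_mul_mulSingle (θ : Fin p → ℤˣ) {i : Fin p} (hi : (i : ℕ) < k) :
    signVector k (θ * Pi.mulSingle i (-1))
      = signVector k θ - Pi.single i (2 * ((θ i : ℤ) : ℝ)) := by
  ext j
  by_cases hj : j = i
  · subst hj
    simp [signVector, hi]
    ring
  · simp [signVector, hj]

/-- Flipping the sign `θ i` amounts to a shear of the standard Gaussian vector in direction `i`. -/
lemma shearMatrix_flip_mulVec (e : ℝ) (θ : Fin p → ℤˣ) {i : Fin p} (hi : (i : ℕ) < k)
    (x : Fin p → ℝ) :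
    (shearMatrix k (-e) (θ * Pi.mulSingle i (-1))).mulVec x
      = (shearMatrix k (-e) θ).mulVec
        (Function.update x i (x i + 2 * e * ((θ i : ℤ) : ℝ) * (blockVector p k ⬝ᵥ x))) := by
  have hw : blockVector p k i = 0 := by simp [blockVector, not_le.2 hi]
  rw [shearMatrix_mulVec, shearMatrix_mulVec, dotProduct_update_of_eq_zero hw,
    signVector_mul_mulSingle θ hi]
  ext j
  by_cases hj : j = i
  · subst hj
    simp
    ring
  · simp [hj]

lemma half_le_flip_testing_error {n : ℕ} {a e : ℝ} (hk : 2 * k ≤ p)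
    (hek : e ^ 2 * k ≤ 1 / 16) (hn : n * (8 * (e ^ 2 * k)) ≤ 1 / 2) (θ : Fin p → ℤˣ)
    {i : Fin p} (hi : (i : ℕ) < k) {D : Set (Fin n → EuclideanSpace ℝ (Fin p))}
    (hD : MeasurableSet D) :
    1 / 2 ≤ Measure.pi (fun _ => gaussianLaw ((√a)⁻¹ • shearMatrix k (-e) θ)) D
      + Measure.pi (fun _ =>
          gaussianLaw ((√a)⁻¹ • shearMatrix k (-e) (θ * Pi.mulSingle i (-1)))) Dᶜ := by
  have hw : blockVector p k i = 0 := by simp [blockVector, not_le.2 hi]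
  set c := 2 * e * ((θ i : ℤ) : ℝ) with hc
  have hcsq : c ^ 2 * (blockVector p k ⬝ᵥ blockVector p k) = 4 * (e ^ 2 * k) := by
    rw [blockVector_dotProduct_self hk, hc]
    linear_combination 4 * e ^ 2 * k * unit_mul_self_cast (θ i)
  have h := half_le_testing_error_gaussianLaw (n := n) (ι := Unit)
    (A := (√a)⁻¹ • shearMatrix k (-e) θ)
    (A' := fun _ => (√a)⁻¹ • shearMatrix k (-e) (θ * Pi.mulSingle i (-1)))
    (S := fun _ x => Function.update x i (x i + c * (blockVector p k ⬝ᵥ x)))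
    (L := fun _ => shearDensity (blockVector p k) c i) ?_
    (fun _ => measurable_shearDensity _ _ _) ?_ (fun _ => map_shear_pi_gaussianReal hw c) ?_ hD
  · simpa using h
  · intro _
    have hm := measurable_dotProduct_left (blockVector p k)
    exact (measurable_update' (a := i)).comp (measurable_id.prodMk
      (by fun_prop : Measurable fun x : Fin p → ℝ => x i + c * (blockVector p k ⬝ᵥ x)))
  · intro _ g
    rw [Matrix.smul_mulVec, Matrix.smul_mulVec, shearMatrix_flip_mulVec e θ hi]
  · have h1 := lintegral_shearDensity_mul_self_le hw (c := c) (by rw [hcsq]; linarith)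
    rw [hcsq] at h1
    simp only [Finset.univ_unique, Finset.sum_singleton, Fintype.card_unit, Nat.cast_one, one_pow,
      mul_one]
    refine (pow_le_pow_left₀ zero_le h1 n).trans ?_
    rw [← ENNReal.ofReal_pow (Real.exp_pos _).le, ← Real.exp_nat_mul]
    refine ENNReal.ofReal_le_of_le_toReal ?_
    have h2 : Real.exp (n * (2 * (4 * (e ^ 2 * k)))) ≤ Real.exp (1 / 2) :=
      Real.exp_le_exp.2 (by linarith)
    have h3 : Real.exp (1 / 2) ^ 2 ≤ 4 := by
      rw [← Real.exp_nat_mul]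
      have := Real.exp_one_lt_d9
      norm_num
      linarith
    have h4 : Real.exp (1 / 2) ≤ 2 := by nlinarith [Real.exp_pos (1 / 2)]
    simpa using h2.trans h4

/-- Assouad's argument: averaged over the signs `θ`, the risk is at least the sum over the first
block of the testing errors between `θ` and its flip at one position. The operator norm is bounded
below by testing the error matrix on the indicator of the second block. -/
lemma le_minimaxRisk_of_shears {n : ℕ} {a e α M₀ M ρ : ℝ} (hk1 : 1 ≤ k) (hk : 2 * k ≤ p)
    (hα : 0 < α) (hρ : 0 < ρ) (hM : 0 < M) (ha : 0 < a) (he : 0 ≤ e) (hek : e * k ≤ 1)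
    (h1 : max ρ M₀⁻¹ ≤ a * (1 - 2 * (e * k))) (h2 : a * (1 + e * k) ^ 2 ≤ M₀)
    (hdec : 6 * a * (e * k) ≤ M * ((2 * k : ℕ) : ℝ) ^ (-α))
    (hek' : e ^ 2 * k ≤ 1 / 16) (hn : n * (8 * (e ^ 2 * k)) ≤ 1 / 2) :
    ENNReal.ofReal (a ^ 2 * (e * k) ^ 2 / 4) ≤
      operatorNormMinimaxRisk n {P ∈ bandablePrecisionLaws p α M₀ M ρ | ∫ x, x ∂P = 0} := by
  refine le_iInf₂ fun est hest => ?_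
  have hk0 : (0 : ℝ) < k := by exact_mod_cast hk1
  set I : Finset (Fin p) := Finset.univ.filter fun i => (i : ℕ) < k with hI
  have hIcard : (I.card : ℝ≥0∞) = k := by
    have h := sum_ite_fin (p := p) 0 k (by omega)
    simp only [Nat.zero_le, true_and, Finset.sum_boole, Nat.sub_zero] at h
    exact_mod_cast h
  set w := blockVector p k with hw
  set Pθ : (Fin p → ℤˣ) → Measure (EuclideanSpace ℝ (Fin p)) :=
    fun θ => gaussianLaw ((√a)⁻¹ • shearMatrix k (-e) θ) with hPθ
  -- `E θ i`: the sign that the estimator suggests for position `i` is not `θ i`.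
  set E : (Fin p → ℤˣ) → Fin p → Set (Fin n → EuclideanSpace ℝ (Fin p)) :=
    fun θ i => {x | (est x).mulVec w i * ((θ i : ℤ) : ℝ) ≤ 0} with hE
  have hEm : ∀ θ i, MeasurableSet (E θ i) := fun θ i => by
    refine measurableSet_le ?_ measurable_const
    simp only [Matrix.mulVec, dotProduct]
    exact (Finset.measurable_sum _ fun j _ => (hest i j).mul_const _).mul_const _
  set r : ℝ := a ^ 2 * e ^ 2 * k with hr
  have hr0 : 0 ≤ r := by positivity
  have hrisk : ∀ θ, ∑ i ∈ I, ENNReal.ofReal r * Measure.pi (fun _ : Fin n => Pθ θ) (E θ i)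
      ≤ operatorNormRisk est (Pθ θ) := fun θ => by
    have hind : ∀ i, ENNReal.ofReal r * Measure.pi (fun _ : Fin n => Pθ θ) (E θ i)
        = ∫⁻ x, (E θ i).indicator (fun _ => ENNReal.ofReal r) x
          ∂(Measure.pi fun _ : Fin n => Pθ θ) := fun i => by
      rw [lintegral_indicator_const (hEm θ i)]
    simp_rw [hind]
    rw [← lintegral_finsetSum _ fun i _ => measurable_const.indicator (hEm θ i), operatorNormRisk]
    refine lintegral_mono fun x => ?_
    have hreal : ∑ i ∈ I, (E θ i).indicator (fun _ => r) x
        ≤ matrixSpectralNorm (est x - precisionMatrix (Pθ θ)) ^ 2 := by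
      have h3 := sum_sq_mulVec_le (est x - precisionMatrix (Pθ θ)) w
      have hww : ∑ i, w i ^ 2 = k := by
        rw [← blockVector_dotProduct_self hk]
        exact Finset.sum_congr rfl fun i _ => pow_two _
      rw [hww] at h3
      refine le_of_mul_le_mul_right (le_trans ?_ h3) hk0
      rw [Finset.sum_mul]
      refine le_trans (Finset.sum_le_sum fun i hi => ?_)
        (Finset.sum_le_sum_of_subset_of_nonneg (Finset.subset_univ I) fun i _ _ => sq_nonneg _)
      by_cases hx : x ∈ E θ i
      · rw [Set.indicator_of_mem hx]
        simp only [hE, Set.mem_ofPred_eq] at hx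
        rw [hPθ, precisionMatrix_gaussianLaw (inv_sqrt_smul_mul ha (shearMatrix_neg_mul e θ)),
          Matrix.sub_mulVec, Pi.sub_apply,
          shear_gram_mulVec_blockVector hk a e ha.le θ (Finset.mem_filter.1 hi).2]
        have hpos : 0 ≤ a * e * k := by positivity
        have hsq := unit_mul_self_cast (θ i)
        -- The cross term has the right sign exactly because the guess is wrong.
        have hexp : ((est x).mulVec w i - a * e * k * ((θ i : ℤ) : ℝ)) ^ 2
            = (est x).mulVec w i ^ 2 - 2 * (a * e * k) * ((est x).mulVec w i * ((θ i : ℤ) : ℝ))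
              + r * k := by
          rw [hr]
          linear_combination (a * e * k) ^ 2 * hsq
        rw [hexp]
        nlinarith [sq_nonneg ((est x).mulVec w i), mul_nonneg hpos (neg_nonneg.2 hx)]
      · rw [Set.indicator_of_notMem hx, zero_mul]
        exact sq_nonneg _
    refine le_trans (le_of_eq ?_) (ENNReal.ofReal_le_ofReal hreal)
    rw [ENNReal.ofReal_sum_of_nonneg fun i _ => Set.indicator_nonneg (fun _ _ => hr0) x]
    refine Finset.sum_congr rfl fun i _ => ?_
    by_cases hx : x ∈ E θ i <;> simp [hx]
  have hflip : ∀ i ∈ I, (Fintype.card (Fin p → ℤˣ) : ℝ≥0∞) * (1 / 2)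
      ≤ 2 * ∑ θ, Measure.pi (fun _ : Fin n => Pθ θ) (E θ i) := fun i hi => by
    -- Pairing every `θ` with its flip at `i` reduces the sum to testing errors.
    have hswap := Equiv.sum_comp (Equiv.mulRight (Pi.mulSingle i (-1) : Fin p → ℤˣ))
      fun θ => Measure.pi (fun _ : Fin n => Pθ θ) (E θ i)
    rw [two_mul]
    nth_rw 2 [← hswap]
    rw [← Finset.sum_add_distrib, ← nsmul_eq_mul, ← Finset.card_univ, ← Finset.sum_const]
    refine Finset.sum_le_sum fun θ _ => ?_
    refine (half_le_flip_testing_error (a := a) hk hek' hn θ (Finset.mem_filter.1 hi).2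
      (hEm θ i)).trans ?_
    refine add_le_add le_rfl (measure_mono fun x hx => ?_)
    simp only [hE, Set.mem_compl_iff, Set.mem_ofPred_eq, not_le] at hx ⊢
    simp
    linarith
  set R := ⨆ P ∈ {P ∈ bandablePrecisionLaws p α M₀ M ρ | ∫ x, x ∂P = 0}, operatorNormRisk est P
  have hR : ∀ θ, operatorNormRisk est (Pθ θ) ≤ R := fun θ =>
    le_iSup₂_of_le _ (gaussianLaw_shear_mem hk1 hk hα hρ hM ha he hek h1 h2 hdec θ) le_rfl
  set N := (Fintype.card (Fin p → ℤˣ) : ℝ≥0∞) with hN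
  have hN0 : N ≠ 0 := by simp [hN]
  have hNt : N ≠ ∞ := by simp [hN]
  have htotal : N * (ENNReal.ofReal r * (k * (1 / 2))) ≤ N * (2 * R) := by
    calc N * (ENNReal.ofReal r * (k * (1 / 2)))
        = ENNReal.ofReal r * ∑ i ∈ I, N * (1 / 2) := by
          rw [Finset.sum_const, nsmul_eq_mul, hIcard]; ring
      _ ≤ ENNReal.ofReal r * ∑ i ∈ I, 2 * ∑ θ, Measure.pi (fun _ : Fin n => Pθ θ) (E θ i) := by
          exact mul_le_mul_right (Finset.sum_le_sum hflip) _
      _ = 2 * ∑ θ, ∑ i ∈ I, ENNReal.ofReal r * Measure.pi (fun _ : Fin n => Pθ θ) (E θ i) := by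
          rw [Finset.sum_comm (s := Finset.univ)]
          simp_rw [← Finset.mul_sum]
          ring
      _ ≤ 2 * ∑ _θ : Fin p → ℤˣ, R := by
          gcongr with θ
          exact (hrisk θ).trans (hR θ)
      _ = N * (2 * R) := by
          rw [Finset.sum_const, nsmul_eq_mul, Finset.card_univ]; ring
  have h5 := (ENNReal.mul_le_mul_iff_right hN0 hNt).1 htotal
  have h6 : ENNReal.ofReal (a ^ 2 * (e * k) ^ 2 / 4) * 2 = ENNReal.ofReal r * (k * (1 / 2)) := by
    rw [show (k : ℝ≥0∞) = ENNReal.ofReal (k : ℝ) by simp,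
      show (1 / 2 : ℝ≥0∞) = ENNReal.ofReal (1 / 2) by
        rw [ENNReal.ofReal_div_of_pos two_pos]; simp,
      show (2 : ℝ≥0∞) = ENNReal.ofReal 2 by simp,
      ← ENNReal.ofReal_mul hk0.le, ← ENNReal.ofReal_mul hr0, ← ENNReal.ofReal_mul (by positivity)]
    congr 1
    rw [hr]; ring
  rw [← h6, mul_comm] at h5
  exact (ENNReal.mul_le_mul_iff_right two_ne_zero (by simp)).1 h5

end

/-! ### The two rates -/

lemma operatorNormMinimaxRisk_mono {n p : ℕ} {C C' : Set (Measure (EuclideanSpace ℝ (Fin p)))}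
    (h : C ⊆ C') : operatorNormMinimaxRisk n C ≤ operatorNormMinimaxRisk n C' :=
  iInf₂_mono fun _ _ => biSup_mono h

/-- A block size of exact order `r`, for which two blocks fit into `p > r` coordinates. -/
lemma exists_blockSize {p : ℕ} {r : ℝ} (hr : 1 ≤ r) (hp : r < p) :
    ∃ k : ℕ, 1 ≤ k ∧ 2 * k ≤ p ∧ (k : ℝ) ≤ r ∧ r ≤ 4 * k := by
  have hfl := Nat.floor_le (show 0 ≤ r / 2 by linarith)
  have hlt := Nat.lt_floor_add_one (r / 2)
  refine ⟨max 1 ⌊r / 2⌋₊, le_max_left _ _, ?_, ?_, ?_⟩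
  · have h1 : 1 < p := by exact_mod_cast hr.trans_lt hp
    have h2 : 2 * ⌊r / 2⌋₊ ≤ p := by
      have : (2 * ⌊r / 2⌋₊ : ℝ) ≤ p := by linarith
      exact_mod_cast this
    omega
  · push_cast
    exact max_le hr (by linarith)
  · push_cast
    rcases le_total r 4 with h | h
    · linarith [le_max_left (1 : ℝ) ⌊r / 2⌋₊]
    · linarith [le_max_right (1 : ℝ) ⌊r / 2⌋₊]

/-- With blocks of size `k ≍ r = n ^ (1 / (2 α + 1))` and entries of size `τ r ^ (-α - 1)`, a single
sign flip stays undetectable from `n` observations. -/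
lemma le_minimaxRisk_bandwidth {n p : ℕ} {a τ α M₀ M ρ : ℝ} (hα : 0 < α) (hρ : 0 < ρ) (hM : 0 < M)
    (ha : 0 < a) (hτ : 0 < τ) (hτ4 : τ ≤ 1 / 4) (h1 : max ρ M₀⁻¹ ≤ a * (1 - 2 * τ))
    (h2 : a * (1 + τ) ^ 2 ≤ M₀) (hτM : 6 * a * τ ≤ M * 2 ^ (-α))
    (hn : 1 ≤ n) (hp : (n : ℝ) ^ (1 / (2 * α + 1)) < p) :
    ENNReal.ofReal (a ^ 2 * τ ^ 2 / 64 * (n : ℝ) ^ (-(2 * α / (2 * α + 1)))) ≤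
      operatorNormMinimaxRisk n {P ∈ bandablePrecisionLaws p α M₀ M ρ | ∫ x, x ∂P = 0} := by
  have hn1 : (1 : ℝ) ≤ n := by exact_mod_cast hn
  set r : ℝ := (n : ℝ) ^ (1 / (2 * α + 1)) with hr
  have hr1 : 1 ≤ r := Real.one_le_rpow hn1 (by positivity)
  have hr0 : 0 < r := by linarith
  obtain ⟨k, hk1, hk2, hkr, hrk⟩ := exists_blockSize hr1 hp
  have hk0 : (0 : ℝ) < k := by exact_mod_cast hk1
  set q : ℝ := r ^ (-α) with hq
  have hq0 : 0 < q := Real.rpow_pos_of_pos hr0 _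
  have hq1 : q ≤ 1 := Real.rpow_le_one_of_one_le_of_nonpos hr1 (by linarith)
  set e : ℝ := τ * (q / r) with he
  have he0 : 0 ≤ e := by positivity
  have hek : e * k ≤ τ * q := by
    rw [he, mul_assoc, div_mul_eq_mul_div]
    refine mul_le_mul_of_nonneg_left ?_ hτ.le
    rw [div_le_iff₀ hr0]
    exact mul_le_mul_of_nonneg_left hkr hq0.le
  have hekτ : e * k ≤ τ := hek.trans (by nlinarith)
  have hekl : τ * q ≤ 4 * (e * k) := by
    have : e * r = τ * q := by rw [he]; field_simp
    nlinarith
  have hqq : q ^ 2 = (n : ℝ) ^ (-(2 * α / (2 * α + 1))) := by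
    rw [hq, hr, ← Real.rpow_mul (by positivity), ← Real.rpow_natCast, ← Real.rpow_mul (by positivity)]
    congr 1
    push_cast
    field_simp
  have hrn : n * q ^ 2 = r := by
    rw [hqq, hr]
    nth_rw 1 [← Real.rpow_one (n : ℝ)]
    rw [← Real.rpow_add (by positivity)]
    congr 1
    field_simp
    ring
  have hne : n * (e ^ 2 * k) ≤ 1 / 16 := by
    have h3 : n * (e ^ 2 * r) = τ ^ 2 := by
      rw [he, show n * ((τ * (q / r)) ^ 2 * r) = τ ^ 2 * (n * q ^ 2 / r) by field_simp, hrn,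
        div_self hr0.ne', mul_one]
    have h4 : n * (e ^ 2 * k) ≤ n * (e ^ 2 * r) := by gcongr
    nlinarith
  have hqk : 2 ^ (-α) * q ≤ ((2 * k : ℕ) : ℝ) ^ (-α) := by
    rw [hq, ← Real.mul_rpow (by norm_num) hr0.le]
    refine Real.rpow_le_rpow_of_nonpos (by positivity) ?_ (by linarith)
    push_cast
    linarith
  have h := le_minimaxRisk_of_shears (n := n) (M₀ := M₀) (ρ := ρ) hk1 hk2 hα hρ hM ha he0
    (by linarith)
    (h1.trans (mul_le_mul_of_nonneg_left (by linarith) ha.le))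
    (le_trans (mul_le_mul_of_nonneg_left
      (pow_le_pow_left₀ (by positivity) (by linarith) 2) ha.le) h2)
    (calc 6 * a * (e * k) ≤ 6 * a * (τ * q) := by gcongr
      _ = (6 * a * τ) * q := by ring
      _ ≤ (M * 2 ^ (-α)) * q := by gcongr
      _ = M * (2 ^ (-α) * q) := by ring
      _ ≤ M * ((2 * k : ℕ) : ℝ) ^ (-α) := by gcongr)
    (le_trans (le_mul_of_one_le_left (by positivity) hn1) hne) (by linarith)
  refine (ENNReal.ofReal_le_ofReal ?_).trans h
  rw [← hqq]
  have h5 : (τ * q) ^ 2 ≤ (4 * (e * k)) ^ 2 := pow_le_pow_left₀ (by positivity) hekl 2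
  nlinarith [mul_le_mul_of_nonneg_left h5 (sq_nonneg a)]

/-- The choice `s = 1 + κ √(log p / n)` in `le_minimaxRisk_of_spikes`; the bound `log p ≤ K n` keeps
the perturbed entry inside the spectral window. -/
lemma le_minimaxRisk_log {n p : ℕ} {a t κ K α M₀ M ρ : ℝ} (hρ : 0 < ρ) (hM : 0 < M)
    (ha : 0 < a) (hκ : 0 < κ) (hκ3 : κ ≤ 1 / 3) (ht1 : t ≤ 1) (hκK : κ * √K ≤ t)
    (h1 : max ρ M₀⁻¹ ≤ a) (h2 : a * (1 + t) ^ 2 ≤ M₀)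
    (hn : 1 ≤ n) (hp : 1 ≤ p) (hlog : Real.log p ≤ K * n) :
    ENNReal.ofReal (a ^ 2 * κ ^ 2 / 4 * (Real.log p / n)) ≤
      operatorNormMinimaxRisk n {P ∈ bandablePrecisionLaws p α M₀ M ρ | ∫ x, x ∂P = 0} := by
  have hn0 : (0 : ℝ) < n := by exact_mod_cast hn
  have hl0 : 0 ≤ Real.log p := Real.log_nonneg (by exact_mod_cast hp)
  set y : ℝ := Real.log p / n with hy
  have hy0 : 0 ≤ y := by positivity
  have hny : n * y = Real.log p := by rw [hy]; field_simp
  set d : ℝ := κ * √y with hd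
  have hd0 : 0 ≤ d := by positivity
  have hdt : d ≤ t := by
    refine le_trans (mul_le_mul_of_nonneg_left (Real.sqrt_le_sqrt ?_) hκ.le) hκK
    rwa [hy, div_le_iff₀ hn0]
  have hd2 : d ^ 2 = κ ^ 2 * y := by rw [hd, mul_pow, Real.sq_sqrt hy0]
  have hD : (1 + d) ^ 2 - 1 = d * (2 + d) := by ring
  have h := le_minimaxRisk_of_spikes (n := n) (p := p) (α := α) (M₀ := M₀) (M := M) (ρ := ρ)
    (s := 1 + d) hp hρ hM ha (by linarith) h1
    (le_trans (mul_le_mul_of_nonneg_left (pow_le_pow_left₀ (by positivity) (by linarith) 2) ha.le)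
      h2) ?_
  · refine (ENNReal.ofReal_le_ofReal ?_).trans h
    rw [hD]
    have h3 : 4 * d ^ 2 ≤ (d * (2 + d)) ^ 2 := by
      rw [show 4 * d ^ 2 = (d * 2) ^ 2 by ring]
      exact pow_le_pow_left₀ (by positivity) (mul_le_mul_of_nonneg_left (by linarith) hd0) 2
    rw [hd2] at h3
    nlinarith [mul_le_mul_of_nonneg_left h3 (sq_nonneg a)]
  · rw [hD, ← hny]
    refine mul_le_mul_of_nonneg_left ?_ hn0.le
    have h3 : (d * (2 + d)) ^ 2 ≤ (d * 3) ^ 2 :=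
      pow_le_pow_left₀ (by positivity) (mul_le_mul_of_nonneg_left (by linarith) hd0) 2
    have h4 : κ ^ 2 ≤ 1 / 9 := by nlinarith
    have h5 : κ ^ 2 * y ≤ 1 / 9 * y := mul_le_mul_of_nonneg_right h4 hy0
    nlinarith

theorem theorem2 (α M₀ M ρ K : ℝ) (hα : 0 < α) (hM₀ : 1 < M₀) (hM : 0 < M)
    (hρ : 0 < ρ) (hρM₀ : ρ < M₀) (hK : 0 < K) :
    ∃ c : ℝ, 0 < c ∧ ∀ n p : ℕ, 1 ≤ n →
      (n : ℝ) ^ (1 / (2 * α + 1)) < (p : ℝ) → Real.log p ≤ K * n →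
        ENNReal.ofReal (c * (n : ℝ) ^ (-(2 * α / (2 * α + 1))) + c * (Real.log p / n)) ≤
            operatorNormMinimaxRisk n (bandablePrecisionLaws p α M₀ M ρ) ∧
        ENNReal.ofReal (c * (n : ℝ) ^ (-(2 * α / (2 * α + 1))) + c * (Real.log p / n)) ≤
            operatorNormMinimaxRisk n {P ∈ bandablePrecisionLaws p α M₀ M ρ | ∫ x, x ∂P = 0} := by
  -- `a` lies strictly inside the admissible spectral window `[m, M₀]`, and perturbations of
  -- relative size `t` around `a` stay inside it.
  set m := max ρ M₀⁻¹ with hm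
  have hm0 : 0 < m := lt_max_of_lt_left hρ
  have hmM : m < M₀ := max_lt hρM₀ ((inv_lt_one_of_one_lt₀ hM₀).trans hM₀)
  set a := (m + M₀) / 2 with ha
  have ham : m < a := by linarith
  have haM : a < M₀ := by linarith
  have ha0 : 0 < a := by linarith
  set t := min (1 / 4) (min ((a - m) / (2 * a)) ((M₀ - a) / (3 * a))) with ht
  have ht0 : 0 < t :=
    lt_min (by norm_num) (lt_min (div_pos (by linarith) (by linarith))
      (div_pos (by linarith) (by linarith)))
  have ht4 : t ≤ 1 / 4 := min_le_left _ _
  have htm : t * (2 * a) ≤ a - m :=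
    (le_div_iff₀ (by linarith)).1 ((min_le_right _ _).trans (min_le_left _ _))
  have htM : t * (3 * a) ≤ M₀ - a :=
    (le_div_iff₀ (by linarith)).1 ((min_le_right _ _).trans (min_le_right _ _))
  have hup : ∀ x, 0 ≤ x → x ≤ t → a * (1 + x) ^ 2 ≤ M₀ := fun x hx0 hx => by
    have h3 : (1 + x) ^ 2 ≤ 1 + 3 * t := by nlinarith
    nlinarith [mul_le_mul_of_nonneg_left h3 ha0.le]
  have h2α : (0 : ℝ) < 2 ^ (-α) := by positivity
  set τ := min t (M * 2 ^ (-α) / (6 * a)) with hτ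
  have hτ0 : 0 < τ := lt_min ht0 (by positivity)
  have hτt : τ ≤ t := min_le_left _ _
  have hτM : 6 * a * τ ≤ M * 2 ^ (-α) := by
    rw [mul_comm]
    exact (le_div_iff₀ (by positivity)).1 (min_le_right _ _)
  have hKs : 0 < √K := Real.sqrt_pos.2 hK
  set κ := min (1 / 3) (t / √K) with hκ
  have hκ0 : 0 < κ := lt_min (by norm_num) (by positivity)
  have hκK : κ * √K ≤ t := (le_div_iff₀ hKs).1 (min_le_right _ _)
  set c₁ := a ^ 2 * τ ^ 2 / 64 with hc₁
  set c₂ := a ^ 2 * κ ^ 2 / 4 with hc₂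
  have hc : 0 < min c₁ c₂ := lt_min (by positivity) (by positivity)
  refine ⟨min c₁ c₂ / 2, by linarith, fun n p hn hp hlog => ?_⟩
  have hn0 : (0 : ℝ) < n := by exact_mod_cast hn
  have hp1 : 1 ≤ p := by
    have : (0 : ℝ) < p := (Real.rpow_pos_of_pos hn0 _).trans hp
    exact_mod_cast this
  have hA := le_minimaxRisk_bandwidth (M₀ := M₀) hα hρ hM ha0 hτ0 (hτt.trans ht4)
    (by rw [← hm]; nlinarith) (hup τ hτ0.le hτt) hτM hn hp
  have hB := le_minimaxRisk_log (α := α) (M₀ := M₀) hρ hM ha0 hκ0 (min_le_left _ _)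
    (by linarith) hκK ham.le (hup t ht0.le le_rfl) hn hp1 hlog
  rw [← hc₁] at hA
  rw [← hc₂] at hB
  have key : ENNReal.ofReal (min c₁ c₂ / 2 * (n : ℝ) ^ (-(2 * α / (2 * α + 1)))
      + min c₁ c₂ / 2 * (Real.log p / n)) ≤
      operatorNormMinimaxRisk n {P ∈ bandablePrecisionLaws p α M₀ M ρ | ∫ x, x ∂P = 0} := by
    have hx : 0 ≤ (n : ℝ) ^ (-(2 * α / (2 * α + 1))) := by positivity
    have hy : 0 ≤ Real.log p / n :=
      div_nonneg (Real.log_nonneg (by exact_mod_cast hp1)) hn0.le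
    have h3 := mul_le_mul_of_nonneg_right (min_le_left c₁ c₂) hx
    have h4 := mul_le_mul_of_nonneg_right (min_le_right c₁ c₂) hy
    rcases le_total (c₁ * (n : ℝ) ^ (-(2 * α / (2 * α + 1)))) (c₂ * (Real.log p / n)) with h | h
    · exact (ENNReal.ofReal_le_ofReal (by linarith)).trans hB
    · exact (ENNReal.ofReal_le_ofReal (by linarith)).trans hA
  exact ⟨key.trans (operatorNormMinimaxRisk_mono fun P hP => hP.1), key⟩
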